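/- Let $\phi:U\to (N,h)$ be a smooth map from an open set $U\subseteq\mathbb R^m$, with the flat metric, into a Riemannian manifold. Its tension field is $\tau(\phi)=\mathrm{Tr}\,\nabla d\phi$, and $\phi$ is harmonic if $\tau(\phi)=0$ on $U$. It is biharmonic if its bitension field $$\tau_2(\phi)=-\mathrm{Tr}\,(\nabla^\phi)^2\tau(\phi)-\mathrm{Tr}\,R^N(\tau(\phi),d\phi)\,d\phi$$ vanishes on $U$, where $R^N(X,Y)Z=\nabla_X\nabla_YZ-\nabla_Y\nabla_XZ-\nabla_{[X,Y]}Z$, and proper biharmonic if it is biharmonic but not harmonic. Let $a,b\in\mathbb R^4$, $\alpha\in\mathbb R\setminus\{0\}$, $A\in O(4)$ and $\varepsilon\in\{0,2\}$, and consider the Möbius transformation $$\phi(x)=a+\frac{\alpha A(x-b)}{|x-b|^{\varepsilon}},$$ which is defined on $U=\mathbb R^4$ if $\varepsilon=0$ and on $U=\mathbb R^4\setminus\{b\}$ if $\varepsilon=2$. 1. As a map from $U$ with the flat metric into flat $\mathbb R^4$, $\phi$ is biharmonic, and it is proper biharmonic if and only if $\varepsilon\neq0$. 2. Let $\sigma^{-1}:\mathbb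 R^4\to S^4\subset\mathbb R^5$, $\sigma^{-1}(y)=\frac{1}{1+|y|^2}\,(2y,\ |y|^2-1)$, be inverse stereographic projection, where $S^4$ is the unit sphere with its standard round metric, so that the metric pulled back to $\mathbb R^4$ is $4\,dx^2/(1+|x|^2)^2$. Then $\sigma^{-1}\circ\phi:U\to S^4$, viewed as a map from $U$ with the flat metric into $S^4$, is always proper biharmonic. So is the map $\mathbb R^4\to S^4=\mathbb R^4\cup\{\infty\}$ that it defines on all of flat $\mathbb R^4$, with $b\mapsto\infty$ (the north pole $(0,0,0,0,1)$) when $\varepsilon=2$. -/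

import Mathlib

open scoped Manifold ContDiff

noncomputable section

/-- The partial derivative `∂ᵢ f` of a function on `ℝᵐ`. -/
def partialDeriv {m : ℕ} {F : Type*} [NormedAddCommGroup F] [NormedSpace ℝ F] (i : Fin m)
    (f : EuclideanSpace ℝ (Fin m) → F) (x : EuclideanSpace ℝ (Fin m)) : F :=
  fderiv ℝ f x (EuclideanSpace.single i 1)

/-! ### Riemannian metrics in coordinates

A Riemannian metric on an open subset of `ℝⁿ` is given by its matrix `h` of components
`h_{ij} = h(∂ᵢ, ∂ⱼ)`. -/

/-- The Christoffel symbols of the Levi-Civita connection,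
`Γᵏ_{ij} = ½ ∑ₗ hᵏˡ (∂ᵢ h_{jl} + ∂ⱼ h_{il} - ∂ₗ h_{ij})`. -/
def christoffel {n : ℕ} (h : EuclideanSpace ℝ (Fin n) → Matrix (Fin n) (Fin n) ℝ)
    (k i j : Fin n) (y : EuclideanSpace ℝ (Fin n)) : ℝ :=
  (1 / 2 : ℝ) * ∑ l, (h y)⁻¹ k l *
    (partialDeriv i (fun z => h z j l) y + partialDeriv j (fun z => h z i l) y
      - partialDeriv l (fun z => h z i j) y)

/-- The components `Rˡ_{ijk}` of the Riemann curvature tensor, `R(∂ᵢ, ∂ⱼ)∂ₖ = ∑ₗ Rˡ_{ijk} ∂ₗ`,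
with the convention `R(X, Y)Z = ∇_X ∇_Y Z - ∇_Y ∇_X Z - ∇_{[X, Y]} Z`. -/
def riemannCurvature {n : ℕ} (h : EuclideanSpace ℝ (Fin n) → Matrix (Fin n) (Fin n) ℝ)
    (l i j k : Fin n) (y : EuclideanSpace ℝ (Fin n)) : ℝ :=
  partialDeriv i (christoffel h l j k) y - partialDeriv j (christoffel h l i k) y
    + ∑ p, (christoffel h l i p y * christoffel h p j k y
      - christoffel h l j p y * christoffel h p i k y)

/-! ### Tension field and bitension field in coordinates

Here `φ` is a map from Euclidean space `ℝᵐ` (with the flat metric and its standard orthonormal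
coordinates) to an open subset of `ℝⁿ` carrying the metric `h`. -/

/-- The components of `∇^φ_{∂ᵢ} V` for a vector field `V` along `φ`, where `∇^φ` is the
connection on `φ⁻¹TN` that is induced by the Levi-Civita connection of `h`. -/
def covDerivAlong {m n : ℕ} (h : EuclideanSpace ℝ (Fin n) → Matrix (Fin n) (Fin n) ℝ)
    (φ : EuclideanSpace ℝ (Fin m) → EuclideanSpace ℝ (Fin n)) (i : Fin m)
    (V : EuclideanSpace ℝ (Fin m) → Fin n → ℝ) (x : EuclideanSpace ℝ (Fin m)) (c : Fin n) : ℝ :=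
  partialDeriv i (fun z => V z c) x
    + ∑ p, ∑ q, christoffel h c p q (φ x) * partialDeriv i (fun z => φ z p) x * V x q

/-- The components of the tension field `τ(φ) = Tr ∇dφ = ∑ᵢ ∇^φ_{∂ᵢ} (dφ(∂ᵢ))`. -/
def tensionField {m n : ℕ} (h : EuclideanSpace ℝ (Fin n) → Matrix (Fin n) (Fin n) ℝ)
    (φ : EuclideanSpace ℝ (Fin m) → EuclideanSpace ℝ (Fin n))
    (x : EuclideanSpace ℝ (Fin m)) (c : Fin n) : ℝ :=
  ∑ i, covDerivAlong h φ i (fun z d => partialDeriv i (fun w => φ w d) z) x c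

/-- The components of the bitension field
`τ₂(φ) = - Tr (∇^φ)² τ(φ) - Tr R^N(τ(φ), dφ)dφ`. -/
def bitensionField {m n : ℕ} (h : EuclideanSpace ℝ (Fin n) → Matrix (Fin n) (Fin n) ℝ)
    (φ : EuclideanSpace ℝ (Fin m) → EuclideanSpace ℝ (Fin n))
    (x : EuclideanSpace ℝ (Fin m)) (c : Fin n) : ℝ :=
  - (∑ i, covDerivAlong h φ i (covDerivAlong h φ i (tensionField h φ)) x c)
  - ∑ i, ∑ p, ∑ q, ∑ r, riemannCurvature h c p q r (φ x) * tensionField h φ x p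
      * partialDeriv i (fun z => φ z q) x * partialDeriv i (fun z => φ z r) x

/-! ### Harmonic and biharmonic maps from Euclidean space into a manifold

The codomain is a smooth `n`-manifold `N` with the Riemannian metric that is induced by a smooth
immersion `ι : N → F` into a Euclidean space `F`. For `ι = id : ℝⁿ → ℝⁿ` it is the flat metric,
and for the inclusion `Sⁿ → ℝⁿ⁺¹` of the unit sphere it is the standard round metric. -/

/-- The components, in the chart `e` of `N`, of the metric induced by `ι`. -/
def chartMetric {n : ℕ} {N F : Type*} [TopologicalSpace N]
    [NormedAddCommGroup F] [InnerProductSpace ℝ F] (ι : N → F)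
    (e : OpenPartialHomeomorph N (EuclideanSpace ℝ (Fin n))) (y : EuclideanSpace ℝ (Fin n)) :
    Matrix (Fin n) (Fin n) ℝ :=
  Matrix.of fun i j =>
    inner ℝ (partialDeriv i (fun z => ι (e.symm z)) y) (partialDeriv j (fun z => ι (e.symm z)) y)

/-- `φ` is a harmonic map from the open set `U` of Euclidean space `ℝᵐ` to `N`: it is smooth on
`U`, and its tension field, expressed in the charts of `N`, vanishes on `U`. -/
def IsHarmonicMapOn {m : ℕ} (n : ℕ) {N F : Type*} [TopologicalSpace N]
    [ChartedSpace (EuclideanSpace ℝ (Fin n)) N] [NormedAddCommGroup F] [InnerProductSpace ℝ F]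
    (ι : N → F) (φ : EuclideanSpace ℝ (Fin m) → N) (U : Set (EuclideanSpace ℝ (Fin m))) : Prop :=
  ContMDiffOn (𝓡 m) (𝓡 n) ∞ φ U ∧
    ∀ x ∈ U, ∀ e ∈ atlas (EuclideanSpace ℝ (Fin n)) N, φ x ∈ e.source →
      ∀ c, tensionField (chartMetric ι e) (fun z => e (φ z)) x c = 0

/-- `φ` is a biharmonic map from the open set `U` of Euclidean space `ℝᵐ` to `N`: it is smooth on
`U`, and its bitension field, expressed in the charts of `N`, vanishes on `U`. -/
def IsBiharmonicMapOn {m : ℕ} (n : ℕ) {N F : Type*} [TopologicalSpace N]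
    [ChartedSpace (EuclideanSpace ℝ (Fin n)) N] [NormedAddCommGroup F] [InnerProductSpace ℝ F]
    (ι : N → F) (φ : EuclideanSpace ℝ (Fin m) → N) (U : Set (EuclideanSpace ℝ (Fin m))) : Prop :=
  ContMDiffOn (𝓡 m) (𝓡 n) ∞ φ U ∧
    ∀ x ∈ U, ∀ e ∈ atlas (EuclideanSpace ℝ (Fin n)) N, φ x ∈ e.source →
      ∀ c, bitensionField (chartMetric ι e) (fun z => e (φ z)) x c = 0

/-- A proper biharmonic map is a biharmonic map that is not harmonic. -/
def IsProperBiharmonicMapOn {m : ℕ} (n : ℕ) {N F : Type*} [TopologicalSpace N]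
    [ChartedSpace (EuclideanSpace ℝ (Fin n)) N] [NormedAddCommGroup F] [InnerProductSpace ℝ F]
    (ι : N → F) (φ : EuclideanSpace ℝ (Fin m) → N) (U : Set (EuclideanSpace ℝ (Fin m))) : Prop :=
  IsBiharmonicMapOn n ι φ U ∧ ¬ IsHarmonicMapOn n ι φ U

/-! ### Möbius transformations -/

/-- The Möbius transformation `x ↦ a + α A(x - b) / |x - b|^ε` of `ℝⁿ`, where `A ∈ O(n)`. -/
def mobius {n : ℕ} (a b : EuclideanSpace ℝ (Fin n)) (α : ℝ)
    (A : EuclideanSpace ℝ (Fin n) ≃ₗᵢ[ℝ] EuclideanSpace ℝ (Fin n)) (ε : ℕ)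
    (x : EuclideanSpace ℝ (Fin n)) : EuclideanSpace ℝ (Fin n) :=
  a + (α / ‖x - b‖ ^ ε) • A (x - b)

/-- The set of points of `ℝⁿ` with a finite image: all of `ℝⁿ` if `ε = 0`, and `ℝⁿ \ {b}`
otherwise. -/
def mobiusDomain {n : ℕ} (b : EuclideanSpace ℝ (Fin n)) (ε : ℕ) :
    Set (EuclideanSpace ℝ (Fin n)) :=
  {x | ε = 0 ∨ x ≠ b}

/-- The unit sphere `Sⁿ` in `ℝⁿ⁺¹`. -/
abbrev UnitSphere (n : ℕ) : Type :=
  Metric.sphere (0 : EuclideanSpace ℝ (Fin (n + 1))) 1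

/-- The north pole `(0, …, 0, 1)` of `Sⁿ`. -/
def northPole (n : ℕ) : UnitSphere n :=
  ⟨EuclideanSpace.single (Fin.last n) 1, by simp⟩

/-- Inverse stereographic projection from the north pole,
`y ↦ (2y, |y|² - 1) / (|y|² + 1) : ℝⁿ → Sⁿ`. -/
def invStereo {n : ℕ} (y : EuclideanSpace ℝ (Fin n)) : UnitSphere n :=
  ⟨(‖y‖ ^ 2 + 1)⁻¹ •
    WithLp.toLp 2 (Fin.snoc (α := fun _ => ℝ) (fun i => 2 * y i) (‖y‖ ^ 2 - 1)), by
    have hp : (0 : ℝ) < ‖y‖ ^ 2 + 1 := by positivity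
    have hy : ∑ i, (y i) ^ 2 = ‖y‖ ^ 2 := by simp [EuclideanSpace.norm_sq_eq]
    have hs : ‖(WithLp.toLp 2 (Fin.snoc (α := fun _ => ℝ) (fun i => 2 * y i) (‖y‖ ^ 2 - 1)) :
        EuclideanSpace ℝ (Fin (n + 1)))‖ = ‖y‖ ^ 2 + 1 := by
      rw [← sq_eq_sq₀ (norm_nonneg _) hp.le, EuclideanSpace.norm_sq_eq, Fin.sum_univ_castSucc]
      simp only [Fin.snoc_castSucc, Fin.snoc_last, Real.norm_eq_abs, sq_abs, mul_pow,
        ← Finset.mul_sum, hy]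
      ring
    rw [mem_sphere_zero_iff_norm, norm_smul, hs, Real.norm_eq_abs, abs_of_pos (inv_pos.mpr hp)]
    exact inv_mul_cancel₀ hp.ne'⟩

open Classical in
/-- The Möbius transformation as a map into `Sⁿ = ℝⁿ ∪ {∞}`, with `∞` the north pole: the point
`b` is sent to `∞` if `ε ≠ 0`. -/
def mobiusToSphere {n : ℕ} (a b : EuclideanSpace ℝ (Fin n)) (α : ℝ)
    (A : EuclideanSpace ℝ (Fin n) ≃ₗᵢ[ℝ] EuclideanSpace ℝ (Fin n)) (ε : ℕ)
    (x : EuclideanSpace ℝ (Fin n)) : UnitSphere n :=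
  if x ∈ mobiusDomain b ε then invStereo (mobius a b α A ε x) else northPole n

end

/-! Flat target. Christoffel symbols and curvature vanish, so the tension field is the componentwise
Laplacian and the bitension field is minus its square. For `ε = 0` the map is affine, hence
harmonic. For `ε = 2` each component is, up to a constant, a linear form in x - b divided by |x -
b|². In dimension 4 its Laplacian is a nonzero multiple of the linear form divided by |x - b|⁴. That
is the Kelvin transform of a linear form, hence harmonic (`laplacianSum_linear_mul_invQuad_pow`).

Spherical target. Möbius transformations act transitively on stereographic projections up to
similarity. So for both values of ε the map into the sphere is itself an inverse stereographic
projection from some pole w composed with a similarity: the map S = `sphericalParam M w μ c`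
(`exists_mobiusToSphere_eq_sphericalParam`). This formula is smooth at b as well, which also settles
the extended map. The inverses of the atlas charts have the same form with μ = 2 and c = 0
(`exists_symm_eq_sphericalParam`).

It remains to compute for S. Write ρ = (|x - c|² + μ²)⁻¹. The metric pulled back by S is (2μρ)²
times the flat one, and the Gauss formula (`partialDeriv_partialDeriv_sphericalParam`) identifies
its Levi-Civita connection with the tangential part of the ambient derivative. Hence covariant
derivatives computed in any chart push forward to the same vectors of ℝ⁵ as covariant derivatives on
the domain (`sphericalPush_covDerivAlong`), and everything can be computed there with explicit
fields. In dimension 4 the tension field is τ = 4ρ(x - c). The trace of its second covariant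
derivative is -12μ²ρ²τ, and the curvature term, with curvature 1, is +12μ²ρ²τ. They cancel, so S is
biharmonic; since τ vanishes only at c, S is not harmonic. -/

noncomputable section

/-! ### Calculus rules for partial derivatives. -/

section PartialDeriv

variable {m : ℕ} {F : Type*} [NormedAddCommGroup F] [NormedSpace ℝ F]
  {f g : EuclideanSpace ℝ (Fin m) → F} {a b : EuclideanSpace ℝ (Fin m) → ℝ}
  {x : EuclideanSpace ℝ (Fin m)}

theorem partialDeriv_congr {i : Fin m} (h : f =ᶠ[nhds x] g) :
    partialDeriv i f x = partialDeriv i g x := by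
  rw [partialDeriv, partialDeriv, h.fderiv_eq]

theorem partialDeriv_const (i : Fin m) (v : F) : partialDeriv i (fun _ => v) x = 0 := by
  simp [partialDeriv]

theorem partialDeriv_add (i : Fin m) (hf : DifferentiableAt ℝ f x) (hg : DifferentiableAt ℝ g x) :
    partialDeriv i (fun z => f z + g z) x = partialDeriv i f x + partialDeriv i g x := by
  simp [partialDeriv, fderiv_fun_add hf hg]

theorem partialDeriv_sub (i : Fin m) (hf : DifferentiableAt ℝ f x) (hg : DifferentiableAt ℝ g x) :
    partialDeriv i (fun z => f z - g z) x = partialDeriv i f x - partialDeriv i g x := by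
  simp [partialDeriv, fderiv_fun_sub hf hg]

theorem partialDeriv_mul (i : Fin m) (ha : DifferentiableAt ℝ a x) (hb : DifferentiableAt ℝ b x) :
    partialDeriv i (fun z => a z * b z) x = partialDeriv i a x * b x + a x * partialDeriv i b x := by
  simp [partialDeriv, fderiv_fun_mul ha hb]
  ring

theorem partialDeriv_const_mul (i : Fin m) (r : ℝ) (ha : DifferentiableAt ℝ a x) :
    partialDeriv i (fun z => r * a z) x = r * partialDeriv i a x := by
  rw [partialDeriv_mul i (by fun_prop) ha, partialDeriv_const]; ring

theorem partialDeriv_pow (i : Fin m) (k : ℕ) (ha : DifferentiableAt ℝ a x) :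
    partialDeriv i (fun z => a z ^ k) x = k * a x ^ (k - 1) * partialDeriv i a x := by
  simp [partialDeriv, fderiv_fun_pow k ha]

theorem partialDeriv_smul (i : Fin m) (ha : DifferentiableAt ℝ a x) (hf : DifferentiableAt ℝ f x) :
    partialDeriv i (fun z => a z • f z) x = partialDeriv i a x • f x + a x • partialDeriv i f x := by
  simp [partialDeriv, fderiv_fun_smul ha hf]
  abel

theorem partialDeriv_sum {ι : Type*} (s : Finset ι) (i : Fin m)
    {f : ι → EuclideanSpace ℝ (Fin m) → F} (hf : ∀ j ∈ s, DifferentiableAt ℝ (f j) x) :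
    partialDeriv i (fun z => ∑ j ∈ s, f j z) x = ∑ j ∈ s, partialDeriv i (f j) x := by
  simp [partialDeriv, fderiv_fun_sum hf]

theorem partialDeriv_coord_sub (c : EuclideanSpace ℝ (Fin m)) (i j : Fin m) :
    partialDeriv i (fun z => z j - c j) x = if j = i then 1 else 0 := by
  have h : HasFDerivAt (fun z : EuclideanSpace ℝ (Fin m) => z j - c j)
      (EuclideanSpace.proj j : EuclideanSpace ℝ (Fin m) →L[ℝ] ℝ) x :=
    (EuclideanSpace.proj (𝕜 := ℝ) j).hasFDerivAt.sub_const _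
  simp [partialDeriv, h.fderiv]

theorem partialDeriv_linear_comp_sub (L : EuclideanSpace ℝ (Fin m) →L[ℝ] F)
    (c : EuclideanSpace ℝ (Fin m)) (i : Fin m) :
    partialDeriv i (fun z => L (z - c)) x = L (EuclideanSpace.single i 1) := by
  have h : HasFDerivAt (fun z : EuclideanSpace ℝ (Fin m) => L (z - c)) L x := by
    exact L.hasFDerivAt.comp x ((hasFDerivAt_id x).sub_const c)
  rw [partialDeriv, h.fderiv]

theorem partialDeriv_comp {n : ℕ} {f : EuclideanSpace ℝ (Fin n) → F}
    {ψ : EuclideanSpace ℝ (Fin m) → EuclideanSpace ℝ (Fin n)} (i : Fin m)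
    (hf : DifferentiableAt ℝ f (ψ x)) (hψ : DifferentiableAt ℝ ψ x) :
    partialDeriv i (fun z => f (ψ z)) x =
      ∑ p, partialDeriv i (fun z => ψ z p) x • partialDeriv p f (ψ x) := by
  have hp (p : Fin n) : partialDeriv i (fun z => ψ z p) x =
      fderiv ℝ ψ x (EuclideanSpace.single i 1) p := by
    have h : HasFDerivAt (fun z => ψ z p) ((EuclideanSpace.proj p).comp (fderiv ℝ ψ x)) x :=
      (EuclideanSpace.proj (𝕜 := ℝ) p).hasFDerivAt.comp x hψ.hasFDerivAt
    simp [partialDeriv, h.fderiv]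
  rw [partialDeriv, fderiv_fun_comp x hf hψ]
  simp only [hp, ContinuousLinearMap.comp_apply]
  generalize fderiv ℝ ψ x (EuclideanSpace.single i 1) = v
  conv_lhs => rw [← (EuclideanSpace.basisFun (Fin n) ℝ).sum_repr v]
  simp [partialDeriv]

theorem ContDiffAt.partialDeriv (i : Fin m) (hf : ContDiffAt ℝ ∞ f x) :
    ContDiffAt ℝ ∞ (partialDeriv i f) x :=
  (hf.fderiv_right (m := ∞) (by simp)).clm_apply contDiffAt_const

end PartialDeriv

/-! ### Spherical parametrizations -/

/-- The function `(|x - c|² + μ²)⁻¹`. -/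
def invQuad {n : ℕ} (μ : ℝ) (c x : EuclideanSpace ℝ (Fin n)) : ℝ :=
  (‖x - c‖ ^ 2 + μ ^ 2)⁻¹

section InvQuad

variable {n : ℕ} {μ : ℝ} (c x : EuclideanSpace ℝ (Fin n))

theorem invQuad_pos (hμ : μ ≠ 0) : 0 < invQuad μ c x := by
  unfold invQuad; positivity

/-- This relation eliminates |x - c|². The identities below are polynomial in ρ, μ and the
coordinates modulo it, which is why so many proofs end in a multiple of `hρ`. -/
theorem invQuad_mul_sum_sq (hμ : μ ≠ 0) :
    invQuad μ c x * ∑ i, (x i - c i) ^ 2 = 1 - μ ^ 2 * invQuad μ c x := by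
  have h : ‖x - c‖ ^ 2 = ∑ i, (x i - c i) ^ 2 := by simp [EuclideanSpace.norm_sq_eq]
  have h2 : ‖x - c‖ ^ 2 + μ ^ 2 ≠ 0 := by positivity
  rw [← h, invQuad]
  field_simp
  ring

theorem contDiff_invQuad (hμ : μ ≠ 0) : ContDiff ℝ ∞ (invQuad μ c) := by
  unfold invQuad
  refine ContDiff.inv (((contDiff_id.sub contDiff_const).norm_sq ℝ).add contDiff_const) fun x => ?_
  positivity

theorem differentiable_invQuad (hμ : μ ≠ 0) : Differentiable ℝ (invQuad μ c) :=
  (contDiff_invQuad c hμ).differentiable (by simp)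

/-- The hypothesis is pointwise so that μ = 0 is allowed away from c; the flat case uses |x - b|⁻²
in this form. -/
theorem hasFDerivAt_invQuad {x : EuclideanSpace ℝ (Fin n)} (h0 : ‖x - c‖ ^ 2 + μ ^ 2 ≠ 0) :
    HasFDerivAt (invQuad μ c)
      (-((‖x - c‖ ^ 2 + μ ^ 2) ^ 2)⁻¹ • (2 • (innerSL ℝ (x - c)))) x := by
  have h : HasFDerivAt (fun z => ‖z - c‖ ^ 2 + μ ^ 2)
      (2 • (innerSL ℝ (x - c))) x := by
    simpa using (((hasFDerivAt_id x).sub_const c).norm_sq).add_const (μ ^ 2)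
  exact (hasDerivAt_inv h0).comp_hasFDerivAt x h

theorem partialDeriv_invQuad_of_ne {x : EuclideanSpace ℝ (Fin n)} (h0 : ‖x - c‖ ^ 2 + μ ^ 2 ≠ 0)
    (i : Fin n) :
    partialDeriv i (invQuad μ c) x = -2 * (x i - c i) * invQuad μ c x ^ 2 := by
  rw [partialDeriv, (hasFDerivAt_invQuad c h0).fderiv]
  simp [invQuad, EuclideanSpace.inner_single_right]
  ring

theorem partialDeriv_invQuad (hμ : μ ≠ 0) (i : Fin n) :
    partialDeriv i (invQuad μ c) x = -2 * (x i - c i) * invQuad μ c x ^ 2 :=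
  partialDeriv_invQuad_of_ne c (by positivity) i

end InvQuad

/-- The Christoffel symbols of the conformally flat metric
`4μ² (|x - c|² + μ²)⁻² ∑ᵢ dxᵢ²`. -/
def sphericalChristoffel {n : ℕ} (μ : ℝ) (c : EuclideanSpace ℝ (Fin n)) (k i j : Fin n)
    (x : EuclideanSpace ℝ (Fin n)) : ℝ :=
  -2 * invQuad μ c x * ((x i - c i) * (if j = k then 1 else 0)
    + (x j - c j) * (if i = k then 1 else 0) - (x k - c k) * (if i = j then 1 else 0))

/-- The inverse stereographic projection `ℝⁿ → Sⁿ` onto the unit sphere with pole `w`, precomposed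
with a similarity of `ℝⁿ`. -/
def sphericalParam {n : ℕ} {F : Type*} [NormedAddCommGroup F] [InnerProductSpace ℝ F]
    (L : EuclideanSpace ℝ (Fin n) →ₗᵢ[ℝ] F) (w : F) (μ : ℝ) (c x : EuclideanSpace ℝ (Fin n)) : F :=
  w - (2 * μ * invQuad μ c x) • (μ • w - L (x - c))

section SphericalParam

variable {n : ℕ} {F : Type*} [NormedAddCommGroup F] [InnerProductSpace ℝ F]
  (L : EuclideanSpace ℝ (Fin n) →ₗᵢ[ℝ] F) {w : F} {μ : ℝ} (c x : EuclideanSpace ℝ (Fin n))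

theorem contDiff_sphericalParam (w : F) (hμ : μ ≠ 0) : ContDiff ℝ ∞ (sphericalParam L w μ c) := by
  have h := contDiff_invQuad c hμ
  have h2 : ContDiff ℝ ∞ fun x => L (x - c) :=
    L.toContinuousLinearMap.contDiff.comp (contDiff_id.sub contDiff_const)
  unfold sphericalParam
  fun_prop

/-- With T = μw - L(x - c) one has |T|² = ρ⁻¹ and ⟨w, T⟩ = μ, so the point is the reflection of the
unit vector w in the hyperplane orthogonal to T. -/
theorem norm_sphericalParam (hw : ‖w‖ = 1) (hLw : ∀ z, inner ℝ (L z) w = 0) (hμ : μ ≠ 0) :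
    ‖sphericalParam L w μ c x‖ = 1 := by
  have h0 : ‖x - c‖ ^ 2 + μ ^ 2 ≠ 0 := by positivity
  have hT : ‖μ • w - L (x - c)‖ ^ 2 = ‖x - c‖ ^ 2 + μ ^ 2 := by
    rw [norm_sub_sq_real, norm_smul, inner_smul_left, real_inner_comm, hLw, L.norm_map]
    simp [hw]; ring
  have hwT : inner ℝ w (μ • w - L (x - c)) = μ := by
    rw [inner_sub_right, real_inner_comm _ w, real_inner_comm _ w, hLw, inner_smul_left]
    simp [hw]
  have : ‖sphericalParam L w μ c x‖ ^ 2 = 1 := by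
    rw [sphericalParam, norm_sub_sq_real, norm_smul, mul_pow, hT, inner_smul_right, hwT]
    simp only [hw, Real.norm_eq_abs, sq_abs, invQuad]
    field_simp
    ring
  exact (pow_eq_one_iff_of_nonneg (norm_nonneg _) two_ne_zero).1 this

theorem partialDeriv_sphericalParam (w : F) (hμ : μ ≠ 0) (k : Fin n) :
    partialDeriv k (sphericalParam L w μ c) x =
      (2 * μ * invQuad μ c x) • L (EuclideanSpace.single k 1)
        + (4 * μ * (x k - c k) * invQuad μ c x ^ 2) • (μ • w - L (x - c)) := by
  have hd := differentiable_invQuad c hμ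
  have hL : DifferentiableAt ℝ (fun z => L (z - c)) x :=
    (L.toContinuousLinearMap.differentiable.comp (differentiable_id.sub_const c)) x
  have hT : DifferentiableAt ℝ (fun z => μ • w - L (z - c)) x := (differentiableAt_const _).sub hL
  have hpL : partialDeriv k (fun z => L (z - c)) x = L (EuclideanSpace.single k 1) :=
    partialDeriv_linear_comp_sub L.toContinuousLinearMap c k
  unfold sphericalParam
  rw [partialDeriv_sub, partialDeriv_const, partialDeriv_smul, partialDeriv_sub, partialDeriv_const,
    hpL, partialDeriv_mul, partialDeriv_const, partialDeriv_invQuad c x hμ]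
  · module
  all_goals first | assumption | exact DifferentiableAt.fun_smul (by fun_prop) hT | fun_prop

theorem inner_partialDeriv_sphericalParam (hw : ‖w‖ = 1) (hLw : ∀ z, inner ℝ (L z) w = 0)
    (hμ : μ ≠ 0) (j k : Fin n) :
    inner ℝ (partialDeriv j (sphericalParam L w μ c) x)
      (partialDeriv k (sphericalParam L w μ c) x) =
        (2 * μ * invQuad μ c x) ^ 2 * if j = k then 1 else 0 := by
  have hρ := invQuad_mul_sum_sq c x hμ
  have hwL (z) : inner ℝ w (L z) = 0 := by rw [real_inner_comm, hLw]
  have hn : ‖x - c‖ ^ 2 = ∑ i, (x i - c i) ^ 2 := by simp [EuclideanSpace.norm_sq_eq]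
  have hww : inner ℝ w w = 1 := by simp [hw]
  rw [partialDeriv_sphericalParam L c x w hμ, partialDeriv_sphericalParam L c x w hμ]
  simp only [inner_add_left, inner_add_right, inner_smul_left, inner_smul_right, inner_sub_left,
    inner_sub_right, LinearIsometry.inner_map_map, hLw, hwL, hww, real_inner_self_eq_norm_sq (x - c),
    hn]
  simp only [EuclideanSpace.inner_single_left, EuclideanSpace.inner_single_right,
    PiLp.single_apply, conj_trivial, eq_comm (a := k)]
  linear_combination (16 * μ ^ 2 * (x j - c j) * (x k - c k) * invQuad μ c x ^ 3) * hρ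

theorem inner_sphericalParam_partialDeriv (hw : ‖w‖ = 1) (hLw : ∀ z, inner ℝ (L z) w = 0)
    (hμ : μ ≠ 0) (k : Fin n) :
    inner ℝ (sphericalParam L w μ c x) (partialDeriv k (sphericalParam L w μ c) x) = 0 := by
  have hρ := invQuad_mul_sum_sq c x hμ
  have hwL (z) : inner ℝ w (L z) = 0 := by rw [real_inner_comm, hLw]
  have hn : ‖x - c‖ ^ 2 = ∑ i, (x i - c i) ^ 2 := by simp [EuclideanSpace.norm_sq_eq]
  have hww : inner ℝ w w = 1 := by simp [hw]
  rw [partialDeriv_sphericalParam L c x w hμ, sphericalParam]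
  simp only [inner_add_right, inner_smul_left, inner_smul_right, inner_sub_left,
    inner_sub_right, LinearIsometry.inner_map_map, hLw, hwL, hww, real_inner_self_eq_norm_sq (x - c),
    hn]
  simp only [EuclideanSpace.inner_single_right, conj_trivial]
  linear_combination (-8 * μ ^ 2 * (x k - c k) * invQuad μ c x ^ 2) * hρ

/-- Gauss formula of the unit sphere: the tangential part is given by the Christoffel symbols, and
the normal part is minus the metric times the position vector. -/
theorem partialDeriv_partialDeriv_sphericalParam (w : F) (hμ : μ ≠ 0) (i j : Fin n) :
    partialDeriv i (partialDeriv j (sphericalParam L w μ c)) x =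
      ∑ k, sphericalChristoffel μ c k i j x • partialDeriv k (sphericalParam L w μ c) x
        - ((2 * μ * invQuad μ c x) ^ 2 * if i = j then 1 else 0) • sphericalParam L w μ c x := by
  have hd := differentiable_invQuad c hμ
  have hL : DifferentiableAt ℝ (fun z => L (z - c)) x :=
    (L.toContinuousLinearMap.differentiable.comp (differentiable_id.sub_const c)) x
  have hT : DifferentiableAt ℝ (fun z => μ • w - L (z - c)) x := (differentiableAt_const _).sub hL
  have hpL : partialDeriv i (fun z => L (z - c)) x = L (EuclideanSpace.single i 1) :=
    partialDeriv_linear_comp_sub L.toContinuousLinearMap c i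
  have hρ := invQuad_mul_sum_sq c x hμ
  have hz : L (x - c) = ∑ k, (x k - c k) • L (EuclideanSpace.single k 1) := by
    conv_lhs => rw [← (EuclideanSpace.basisFun (Fin n) ℝ).sum_repr (x - c)]
    simp [sub_smul]
  -- The radial derivative, which the last term of the Christoffel symbols contributes when i = j.
  have hS : ∑ k, (x k - c k) • partialDeriv k (sphericalParam L w μ c) x =
      (2 * μ * invQuad μ c x) • L (x - c)
        + (4 * μ * invQuad μ c x * (1 - μ ^ 2 * invQuad μ c x)) • (μ • w - L (x - c)) := by
    simp only [partialDeriv_sphericalParam L c x w hμ, smul_add, Finset.sum_add_distrib]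
    congr 1
    · rw [hz, Finset.smul_sum]
      exact Finset.sum_congr rfl fun k _ => smul_comm _ _ _
    · rw [← hρ]
      simp only [smul_smul, ← Finset.sum_smul]
      congr 1
      simp only [Finset.mul_sum]
      exact Finset.sum_congr rfl fun k _ => by ring
  have hG : ∑ k, sphericalChristoffel μ c k i j x • partialDeriv k (sphericalParam L w μ c) x =
      (-2 * invQuad μ c x) • ((x i - c i) • partialDeriv j (sphericalParam L w μ c) x
        + (x j - c j) • partialDeriv i (sphericalParam L w μ c) x
        - (if i = j then (1 : ℝ) else 0) •
          ∑ k, (x k - c k) • partialDeriv k (sphericalParam L w μ c) x) := by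
    simp only [sphericalChristoffel, mul_smul, sub_smul (_ + _) (_ * _),
      add_smul, ← Finset.smul_sum, Finset.sum_sub_distrib, Finset.sum_add_distrib]
    congr 2
    · simp
  rw [hG, hS, show partialDeriv j (sphericalParam L w μ c) = _ from
    funext fun z => partialDeriv_sphericalParam L c z w hμ j]
  rw [partialDeriv_add, partialDeriv_smul, partialDeriv_const, partialDeriv_smul,
    partialDeriv_sub, partialDeriv_const, hpL, partialDeriv_mul, partialDeriv_const,
    partialDeriv_invQuad c x hμ, partialDeriv_mul, partialDeriv_mul, partialDeriv_const,
    partialDeriv_coord_sub, partialDeriv_pow, partialDeriv_invQuad c x hμ,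
    partialDeriv_sphericalParam L c x w hμ, sphericalParam]
  · by_cases h : i = j
    · subst h; simp; module
    · simp [h, Ne.symm h]; module
  all_goals first
    | assumption
    | exact DifferentiableAt.fun_smul (by fun_prop) hT
    | exact DifferentiableAt.fun_smul (by fun_prop) (by fun_prop)
    | fun_prop

end SphericalParam

/-! ### Connection and curvature of the conformally flat metric. -/

section SphericalMetric

variable {n : ℕ} {μ : ℝ} (c : EuclideanSpace ℝ (Fin n))

/-- The matrix of the metric `4μ² (|x - c|² + μ²)⁻² ∑ᵢ dxᵢ²`. -/
def sphericalMetric (μ : ℝ) (c x : EuclideanSpace ℝ (Fin n)) : Matrix (Fin n) (Fin n) ℝ :=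
  (2 * μ * invQuad μ c x) ^ 2 • 1

theorem partialDeriv_sphericalMetric (hμ : μ ≠ 0) (i j l : Fin n) (x : EuclideanSpace ℝ (Fin n)) :
    partialDeriv i (fun z => sphericalMetric μ c z j l) x =
      (2 * μ * invQuad μ c x) ^ 2 * (-4 * (x i - c i) * invQuad μ c x) *
        (if j = l then 1 else 0) := by
  have hd := differentiable_invQuad c hμ
  simp only [sphericalMetric, Matrix.smul_apply, Matrix.one_apply, smul_eq_mul]
  rw [partialDeriv_mul, partialDeriv_const, partialDeriv_pow, partialDeriv_const_mul,
    partialDeriv_invQuad c x hμ]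
  · push_cast
    ring
  all_goals fun_prop

theorem christoffel_sphericalMetric (hμ : μ ≠ 0) :
    christoffel (sphericalMetric μ c) = sphericalChristoffel μ c := by
  funext k i j x
  have hρ := (invQuad_pos c x hμ).ne'
  have hinv : (sphericalMetric μ c x)⁻¹ = ((2 * μ * invQuad μ c x) ^ 2)⁻¹ • 1 := by
    apply Matrix.inv_eq_left_inv
    simp only [sphericalMetric, Matrix.smul_mul, Matrix.one_mul, smul_smul]
    rw [inv_mul_cancel₀ (by positivity), one_smul]
  simp only [christoffel, hinv, partialDeriv_sphericalMetric c hμ, Matrix.smul_apply,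
    Matrix.one_apply, sphericalChristoffel]
  rw [Finset.sum_eq_single k]
  · simp only [if_true, smul_eq_mul]
    field_simp
    ring
  · intro l _ hl
    simp [Ne.symm hl]
  · simp

theorem partialDeriv_sphericalChristoffel (hμ : μ ≠ 0) (l k i j : Fin n)
    (x : EuclideanSpace ℝ (Fin n)) :
    partialDeriv l (sphericalChristoffel μ c k i j) x =
      4 * (x l - c l) * invQuad μ c x ^ 2 * ((x i - c i) * (if j = k then 1 else 0)
        + (x j - c j) * (if i = k then 1 else 0) - (x k - c k) * (if i = j then 1 else 0))
      - 2 * invQuad μ c x * ((if i = l then 1 else 0) * (if j = k then 1 else 0)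
        + (if j = l then 1 else 0) * (if i = k then 1 else 0)
        - (if k = l then 1 else 0) * (if i = j then 1 else 0)) := by
  have hd := differentiable_invQuad c hμ
  unfold sphericalChristoffel
  rw [partialDeriv_mul, partialDeriv_const_mul, partialDeriv_invQuad c x hμ, partialDeriv_sub,
    partialDeriv_add, partialDeriv_mul, partialDeriv_mul, partialDeriv_mul, partialDeriv_coord_sub,
    partialDeriv_coord_sub, partialDeriv_coord_sub, partialDeriv_const, partialDeriv_const,
    partialDeriv_const]
  · ring
  all_goals fun_prop

theorem sum_sphericalChristoffel_mul (k i : Fin n) (x : EuclideanSpace ℝ (Fin n)) (u : Fin n → ℝ) :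
    ∑ j, sphericalChristoffel μ c k i j x * u j =
      -2 * invQuad μ c x * ((x i - c i) * u k
        + (if i = k then 1 else 0) * ∑ j, (x j - c j) * u j - (x k - c k) * u i) := by
  have h (j : Fin n) : sphericalChristoffel μ c k i j x * u j = -2 * invQuad μ c x *
      ((x i - c i) * (if j = k then u j else 0) + (if i = k then 1 else 0) * ((x j - c j) * u j)
        - (x k - c k) * (if i = j then u j else 0)) := by
    unfold sphericalChristoffel
    split_ifs <;> ring
  simp only [h, ← Finset.mul_sum, Finset.sum_sub_distrib, Finset.sum_add_distrib]
  simp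

/-- The metric is that of the unit sphere, so it has constant curvature 1: R(X, Y)Z = ⟨Y, Z⟩X - ⟨X,
Z⟩Y. -/
theorem riemannCurvature_sphericalMetric (hμ : μ ≠ 0) (l i j k : Fin n)
    (x : EuclideanSpace ℝ (Fin n)) :
    riemannCurvature (sphericalMetric μ c) l i j k x =
      (2 * μ * invQuad μ c x) ^ 2 * ((if j = k then 1 else 0) * (if i = l then 1 else 0)
        - (if i = k then 1 else 0) * (if j = l then 1 else 0)) := by
  have hρ := invQuad_mul_sum_sq c x hμ
  have hs (i j k : Fin n) : ∑ p, (x p - c p) * sphericalChristoffel μ c p j k x =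
      -2 * invQuad μ c x * (2 * (x j - c j) * (x k - c k)
        - (if j = k then 1 else 0) * ∑ p, (x p - c p) ^ 2) := by
    have h (p : Fin n) : (x p - c p) * sphericalChristoffel μ c p j k x =
        -2 * invQuad μ c x * ((x j - c j) * (if k = p then x p - c p else 0)
          + (x k - c k) * (if j = p then x p - c p else 0)
          - (if j = k then 1 else 0) * (x p - c p) ^ 2) := by
      unfold sphericalChristoffel
      split_ifs <;> ring
    simp only [h, ← Finset.mul_sum, Finset.sum_sub_distrib, Finset.sum_add_distrib]
    simp only [Finset.sum_ite_eq, Finset.mem_univ, if_true]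
    ring
  rw [riemannCurvature, christoffel_sphericalMetric c hμ, partialDeriv_sphericalChristoffel c hμ,
    partialDeriv_sphericalChristoffel c hμ, Finset.sum_sub_distrib,
    sum_sphericalChristoffel_mul c l i x (fun p => sphericalChristoffel μ c p j k x),
    sum_sphericalChristoffel_mul c l j x (fun p => sphericalChristoffel μ c p i k x), hs i, hs i]
  unfold sphericalChristoffel
  simp only [eq_comm (a := j) (b := i), eq_comm (a := k) (b := i), eq_comm (a := k) (b := j),
    eq_comm (a := l) (b := i), eq_comm (a := l) (b := j)]
  linear_combination (-4 * invQuad μ c x * ((if j = k then 1 else 0) * (if i = l then 1 else 0)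
        - (if i = k then 1 else 0) * (if j = l then 1 else 0))) * hρ

end SphericalMetric

/-! ### Vector fields along maps into the sphere -/

/-- The covariant derivative, with respect to `∂ᵢ`, of the vector field `X` for the metric
`4μ² (|x - c|² + μ²)⁻² ∑ᵢ dxᵢ²`. -/
def sphericalCovDeriv {n : ℕ} (μ : ℝ) (c : EuclideanSpace ℝ (Fin n)) (i : Fin n)
    (X : EuclideanSpace ℝ (Fin n) → Fin n → ℝ) (x : EuclideanSpace ℝ (Fin n)) (k : Fin n) : ℝ :=
  partialDeriv i (fun z => X z k) x + ∑ j, sphericalChristoffel μ c k i j x * X x j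

section Related

variable {n : ℕ} {F : Type*} [NormedAddCommGroup F] [InnerProductSpace ℝ F]
  {L M : EuclideanSpace ℝ (Fin n) →ₗᵢ[ℝ] F} {v w : F} {ν μ : ℝ} {d c : EuclideanSpace ℝ (Fin n)}
  {ψ : EuclideanSpace ℝ (Fin n) → EuclideanSpace ℝ (Fin n)} {W : Set (EuclideanSpace ℝ (Fin n))}

/-- The differential of `sphericalParam` at `x`, applied to the vector with components `u`. -/
def sphericalPush (L : EuclideanSpace ℝ (Fin n) →ₗᵢ[ℝ] F) (w : F) (μ : ℝ)
    (c x : EuclideanSpace ℝ (Fin n)) (u : Fin n → ℝ) : F :=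
  ∑ k, u k • partialDeriv k (sphericalParam L w μ c) x

theorem inner_sphericalPush (hw : ‖w‖ = 1) (hLw : ∀ z, inner ℝ (L z) w = 0) (hμ : μ ≠ 0)
    (x : EuclideanSpace ℝ (Fin n)) (u u' : Fin n → ℝ) :
    inner ℝ (sphericalPush L w μ c x u) (sphericalPush L w μ c x u') =
      (2 * μ * invQuad μ c x) ^ 2 * ∑ k, u k * u' k := by
  simp only [sphericalPush, sum_inner, inner_sum, inner_smul_left, inner_smul_right,
    inner_partialDeriv_sphericalParam L c x hw hLw hμ]
  simp only [mul_ite, mul_one, mul_zero, Finset.mul_sum]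
  exact Finset.sum_congr rfl fun k _ => by simp; ring

theorem sphericalPush_smul (x : EuclideanSpace ℝ (Fin n)) (r : ℝ) (u : Fin n → ℝ) :
    sphericalPush L w μ c x (fun k => r * u k) = r • sphericalPush L w μ c x u := by
  simp [sphericalPush, Finset.smul_sum, mul_smul]

theorem sphericalPush_sum {ι : Type*} (s : Finset ι) (x : EuclideanSpace ℝ (Fin n))
    (u : ι → Fin n → ℝ) :
    sphericalPush L w μ c x (fun k => ∑ i ∈ s, u i k) = ∑ i ∈ s, sphericalPush L w μ c x (u i) := by
  simp only [sphericalPush, Finset.sum_smul]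
  exact Finset.sum_comm

theorem sphericalPush_add (x : EuclideanSpace ℝ (Fin n)) (u u' : Fin n → ℝ) :
    sphericalPush L w μ c x (fun k => u k + u' k) =
      sphericalPush L w μ c x u + sphericalPush L w μ c x u' := by
  simp [sphericalPush, add_smul, Finset.sum_add_distrib]

/-- The push-forward is conformal with nonzero factor, hence injective; pairing with a coordinate
vector isolates one component. -/
theorem sphericalPush_eq_zero (hw : ‖w‖ = 1) (hLw : ∀ z, inner ℝ (L z) w = 0) (hμ : μ ≠ 0)
    {x : EuclideanSpace ℝ (Fin n)} {u : Fin n → ℝ} (h : sphericalPush L w μ c x u = 0) (k : Fin n) :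
    u k = 0 := by
  have h1 := inner_sphericalPush (c := c) hw hLw hμ x u (Pi.single k 1)
  have h2 := (invQuad_pos c x hμ).ne'
  rw [h, inner_zero_left] at h1
  simpa [Pi.single_apply, hμ, h2] using h1

theorem inner_sphericalParam_sphericalPush (hw : ‖w‖ = 1) (hLw : ∀ z, inner ℝ (L z) w = 0)
    (hμ : μ ≠ 0) (x : EuclideanSpace ℝ (Fin n)) (u : Fin n → ℝ) :
    inner ℝ (sphericalParam L w μ c x) (sphericalPush L w μ c x u) = 0 := by
  simp [sphericalPush, inner_sum, inner_smul_right,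
    inner_sphericalParam_partialDeriv L c x hw hLw hμ]

/-- The normal coefficient is left unspecified because it is projected away later. -/
theorem exists_sum_smul_partialDeriv_partialDeriv (hμ : μ ≠ 0) (i : Fin n)
    (x : EuclideanSpace ℝ (Fin n)) (u : Fin n → ℝ) :
    ∃ t : ℝ, ∑ j, u j • partialDeriv i (partialDeriv j (sphericalParam L w μ c)) x =
      sphericalPush L w μ c x (fun k => ∑ j, sphericalChristoffel μ c k i j x * u j)
        + t • sphericalParam L w μ c x := by
  refine ⟨∑ j, -(u j * ((2 * μ * invQuad μ c x) ^ 2 * if i = j then 1 else 0)), ?_⟩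
  rw [sphericalPush_sum, Finset.sum_smul, ← Finset.sum_add_distrib]
  refine Finset.sum_congr rfl fun j _ => ?_
  rw [partialDeriv_partialDeriv_sphericalParam L c x w hμ, sphericalPush, smul_sub, Finset.smul_sum,
    smul_smul, neg_smul, sub_eq_add_neg]
  congr 1
  exact Finset.sum_congr rfl fun k _ => by rw [smul_smul, mul_comm]

theorem differentiableAt_partialDeriv_sphericalParam (hμ : μ ≠ 0) (k : Fin n)
    (x : EuclideanSpace ℝ (Fin n)) :
    DifferentiableAt ℝ (partialDeriv k (sphericalParam L w μ c)) x :=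
  ((contDiff_sphericalParam L c w hμ).contDiffAt.partialDeriv k).differentiableAt (by simp)

/-- The field V is known only through its push-forward. Its components are recovered by pairing with
the coordinate tangent vectors and dividing by the conformal factor, so they inherit
differentiability from X and ψ. -/
theorem differentiableAt_of_sphericalPush_eq (hv : ‖v‖ = 1) (hLv : ∀ z, inner ℝ (L z) v = 0)
    (hν : ν ≠ 0) (hμ : μ ≠ 0) (hW : IsOpen W) (hψ : ∀ z ∈ W, DifferentiableAt ℝ ψ z)
    {V X : EuclideanSpace ℝ (Fin n) → Fin n → ℝ} (hX : ∀ k, Differentiable ℝ fun z => X z k)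
    (hVX : ∀ z ∈ W, sphericalPush L v ν d (ψ z) (V z) = sphericalPush M w μ c z (X z))
    {x : EuclideanSpace ℝ (Fin n)} (hx : x ∈ W) (p : Fin n) :
    DifferentiableAt ℝ (fun z => V z p) x := by
  have h : (fun z => V z p) =ᶠ[nhds x] fun z => ((2 * ν * invQuad ν d (ψ z)) ^ 2)⁻¹ *
      inner ℝ (sphericalPush M w μ c z (X z)) (partialDeriv p (sphericalParam L v ν d) (ψ z)) := by
    filter_upwards [hW.mem_nhds hx] with z hz
    have h1 := inner_sphericalPush (c := d) hv hLv hν (ψ z) (V z) (Pi.single p 1)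
    have h2 := (invQuad_pos d (ψ z) hν).ne'
    have h3 : sphericalPush L v ν d (ψ z) (Pi.single p 1) =
        partialDeriv p (sphericalParam L v ν d) (ψ z) := by
      simp [sphericalPush, Pi.single_apply]
    have h4 : ∑ k, V z k * (Pi.single p 1 : Fin n → ℝ) k = V z p := by simp [Pi.single_apply]
    rw [← hVX z hz, ← h3, h1, h4, inv_mul_cancel_left₀ (by positivity)]
  refine DifferentiableAt.congr_of_eventuallyEq ?_ h
  have h1 : DifferentiableAt ℝ (fun z => invQuad ν d (ψ z)) x :=
    ((differentiable_invQuad d hν) (ψ x)).comp x (hψ x hx)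
  have h2 := (invQuad_pos d (ψ x) hν).ne'
  have h3 : DifferentiableAt ℝ (fun z => partialDeriv p (sphericalParam L v ν d) (ψ z)) x :=
    (differentiableAt_partialDeriv_sphericalParam hν p (ψ x)).comp x (hψ x hx)
  have h4 : DifferentiableAt ℝ (fun z => sphericalPush M w μ c z (X z)) x :=
    DifferentiableAt.fun_sum fun k _ =>
      (hX k x).fun_smul (differentiableAt_partialDeriv_sphericalParam hμ k x)
  have h5 : (2 * ν * invQuad ν d (ψ x)) ^ 2 ≠ 0 := by positivity
  have h6 : DifferentiableAt ℝ (fun z => (2 * ν * invQuad ν d (ψ z)) ^ 2) x := by fun_prop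
  exact (h6.fun_inv h5).fun_mul (h4.inner ℝ h3)

/-- The covariant derivative along a map into the sphere does not depend on the parametrization
of the sphere. -/
theorem sphericalPush_covDerivAlong (hv : ‖v‖ = 1) (hLv : ∀ z, inner ℝ (L z) v = 0)
    (hw : ‖w‖ = 1) (hMw : ∀ z, inner ℝ (M z) w = 0)
    (hν : ν ≠ 0) (hμ : μ ≠ 0) (hW : IsOpen W) (hψ : ∀ z ∈ W, DifferentiableAt ℝ ψ z)
    (hψS : ∀ z ∈ W, sphericalParam L v ν d (ψ z) = sphericalParam M w μ c z)
    {V X : EuclideanSpace ℝ (Fin n) → Fin n → ℝ} (hX : ∀ k, Differentiable ℝ fun z => X z k)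
    (hVX : ∀ z ∈ W, sphericalPush L v ν d (ψ z) (V z) = sphericalPush M w μ c z (X z))
    (i : Fin n) {x : EuclideanSpace ℝ (Fin n)} (hx : x ∈ W) :
    sphericalPush L v ν d (ψ x) (covDerivAlong (sphericalMetric ν d) ψ i V x) =
      sphericalPush M w μ c x (sphericalCovDeriv μ c i X x) := by
  have hV := differentiableAt_of_sphericalPush_eq hv hLv hν hμ hW hψ hX hVX hx
  -- The same ℝ-vector-valued map is differentiated in two descriptions. Each result splits into the
  -- pushed covariant derivative plus a multiple of the position vector.
  have key : partialDeriv i (fun z => sphericalPush L v ν d (ψ z) (V z)) x =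
      partialDeriv i (fun z => sphericalPush M w μ c z (X z)) x := by
    apply partialDeriv_congr
    filter_upwards [hW.mem_nhds hx] with z hz using hVX z hz
  choose s hs using fun q => exists_sum_smul_partialDeriv_partialDeriv (L := L) (w := v) (c := d)
    hν q (ψ x) (V x)
  obtain ⟨t, ht⟩ := exists_sum_smul_partialDeriv_partialDeriv (L := M) (w := w) (c := c) hμ i x (X x)
  have hdL (p : Fin n) :
      DifferentiableAt ℝ (fun z => partialDeriv p (sphericalParam L v ν d) (ψ z)) x :=
    (differentiableAt_partialDeriv_sphericalParam hν p (ψ x)).comp x (hψ x hx)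
  have hdM (k : Fin n) : DifferentiableAt ℝ (fun z => partialDeriv k (sphericalParam M w μ c) z) x :=
    differentiableAt_partialDeriv_sphericalParam hμ k x
  have hl : partialDeriv i (fun z => sphericalPush L v ν d (ψ z) (V z)) x =
      sphericalPush L v ν d (ψ x) (covDerivAlong (sphericalMetric ν d) ψ i V x)
        + (∑ q, partialDeriv i (fun z => ψ z q) x * s q) • sphericalParam L v ν d (ψ x) := by
    have h1 : partialDeriv i (fun z => sphericalPush L v ν d (ψ z) (V z)) x =
        sphericalPush L v ν d (ψ x) (fun p => partialDeriv i (fun z => V z p) x)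
          + ∑ q, partialDeriv i (fun z => ψ z q) x •
            ∑ p, V x p • partialDeriv q (partialDeriv p (sphericalParam L v ν d)) (ψ x) := by
      simp only [sphericalPush]
      rw [partialDeriv_sum _ _ fun p _ => (hV p).fun_smul (hdL p)]
      simp only [fun p => partialDeriv_smul i (hV p) (hdL p),
        fun p => partialDeriv_comp (f := partialDeriv p (sphericalParam L v ν d)) i
          (differentiableAt_partialDeriv_sphericalParam hν p (ψ x)) (hψ x hx)]
      rw [Finset.sum_add_distrib]
      congr 1
      simp only [Finset.smul_sum]
      rw [Finset.sum_comm]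
      exact Finset.sum_congr rfl fun q _ => Finset.sum_congr rfl fun p _ => smul_comm _ _ _
    have h2 : covDerivAlong (sphericalMetric ν d) ψ i V x = fun k =>
        partialDeriv i (fun z => V z k) x + ∑ q, partialDeriv i (fun z => ψ z q) x *
          ∑ p, sphericalChristoffel ν d k q p (ψ x) * V x p := by
      funext k
      simp only [covDerivAlong, christoffel_sphericalMetric d hν, Finset.mul_sum]
      congr 1
      exact Finset.sum_congr rfl fun q _ => Finset.sum_congr rfl fun p _ => by ring
    rw [h1, h2, sphericalPush_add, sphericalPush_sum, add_assoc, Finset.sum_smul,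
      ← Finset.sum_add_distrib]
    congr 1
    refine Finset.sum_congr rfl fun q _ => ?_
    rw [hs, sphericalPush_smul, smul_add, smul_smul]
  have hr : partialDeriv i (fun z => sphericalPush M w μ c z (X z)) x =
      sphericalPush M w μ c x (sphericalCovDeriv μ c i X x) + t • sphericalParam M w μ c x := by
    have h1 : partialDeriv i (fun z => sphericalPush M w μ c z (X z)) x =
        sphericalPush M w μ c x (fun k => partialDeriv i (fun z => X z k) x)
          + ∑ j, X x j • partialDeriv i (partialDeriv j (sphericalParam M w μ c)) x := by
      simp only [sphericalPush]
      rw [partialDeriv_sum _ _ fun k _ => (hX k x).fun_smul (hdM k), ← Finset.sum_add_distrib]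
      exact Finset.sum_congr rfl fun k _ => partialDeriv_smul i (hX k x) (hdM k)
    have h2 : sphericalCovDeriv μ c i X x = fun k =>
        partialDeriv i (fun z => X z k) x + ∑ j, sphericalChristoffel μ c k i j x * X x j := rfl
    rw [h1, h2, sphericalPush_add, ht, add_assoc]
  rw [hl, hr, hψS x hx] at key
  have h3 := inner_sphericalParam_sphericalPush (c := d) hv hLv hν (ψ x)
    (covDerivAlong (sphericalMetric ν d) ψ i V x)
  have h4 := inner_sphericalParam_sphericalPush (c := c) hw hMw hμ x (sphericalCovDeriv μ c i X x)
  rw [hψS x hx] at h3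
  -- Pairing with the unit position vector, which is orthogonal to both tangential parts, shows that
  -- the normal coefficients agree; cancelling them leaves the tangential parts.
  have h5 := congrArg (inner ℝ (sphericalParam M w μ c x)) key
  rw [inner_add_right, inner_add_right, h3, h4, inner_smul_right, inner_smul_right,
    real_inner_self_eq_norm_sq, norm_sphericalParam M c x hw hMw hμ] at h5
  simp only [one_pow, mul_one, zero_add] at h5
  rw [h5] at key
  exact add_right_cancel key

/-- The field dψ(∂ᵢ) corresponds to the constant field ∂ᵢ on the domain; this starts the chain of
transported fields. -/
theorem sphericalPush_partialDeriv (hν : ν ≠ 0) (hW : IsOpen W)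
    (hψ : ∀ z ∈ W, DifferentiableAt ℝ ψ z)
    (hψS : ∀ z ∈ W, sphericalParam L v ν d (ψ z) = sphericalParam M w μ c z)
    (i : Fin n) {x : EuclideanSpace ℝ (Fin n)} (hx : x ∈ W) :
    sphericalPush L v ν d (ψ x) (fun p => partialDeriv i (fun z => ψ z p) x) =
      sphericalPush M w μ c x (fun k => if k = i then 1 else 0) := by
  have h1 : partialDeriv i (fun z => sphericalParam L v ν d (ψ z)) x =
      partialDeriv i (sphericalParam M w μ c) x := by
    apply partialDeriv_congr
    filter_upwards [hW.mem_nhds hx] with z hz using hψS z hz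
  rw [partialDeriv_comp i (((contDiff_sphericalParam L d v hν).differentiable (by simp)) _)
    (hψ x hx)] at h1
  rw [sphericalPush, h1, sphericalPush]
  simp

end Related

/-! ### The tension and the bitension field -/

section Bitension

variable {F : Type*} [NormedAddCommGroup F] [InnerProductSpace ℝ F]
  {L M : EuclideanSpace ℝ (Fin 4) →ₗᵢ[ℝ] F} {v w : F} {ν μ : ℝ} {d c : EuclideanSpace ℝ (Fin 4)}
  {ψ : EuclideanSpace ℝ (Fin 4) → EuclideanSpace ℝ (Fin 4)} {W : Set (EuclideanSpace ℝ (Fin 4))}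

/-- The flat trace of the Christoffel symbols. In dimension n it would be 2(n - 2)ρ(x - c), whence
the 4. -/
theorem sum_sphericalCovDeriv_const (x : EuclideanSpace ℝ (Fin 4)) (k : Fin 4) :
    ∑ i, sphericalCovDeriv μ c i (fun _ k => if k = i then 1 else 0) x k =
      4 * invQuad μ c x * (x k - c k) := by
  simp only [sphericalCovDeriv, partialDeriv_const, sum_sphericalChristoffel_mul]
  fin_cases k <;> simp [Fin.sum_univ_four] <;> ring

theorem sphericalCovDeriv_invQuad_mul (hμ : μ ≠ 0) (x : EuclideanSpace ℝ (Fin 4)) (i k : Fin 4) :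
    sphericalCovDeriv μ c i (fun z k => 4 * invQuad μ c z * (z k - c k)) x k =
      (8 * μ ^ 2 * invQuad μ c x ^ 2 - 4 * invQuad μ c x) * (if i = k then 1 else 0)
        - 8 * invQuad μ c x ^ 2 * (x i - c i) * (x k - c k) := by
  have hd := differentiable_invQuad c hμ
  have hρ := invQuad_mul_sum_sq c x hμ
  have hs : ∑ j, (x j - c j) * (4 * invQuad μ c x * (x j - c j)) =
      4 * (invQuad μ c x * ∑ j, (x j - c j) ^ 2) := by
    simp only [Finset.mul_sum]
    exact Finset.sum_congr rfl fun j _ => by ring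
  rw [sphericalCovDeriv, sum_sphericalChristoffel_mul, hs, hρ, partialDeriv_mul,
    partialDeriv_const_mul, partialDeriv_invQuad c x hμ, partialDeriv_coord_sub]
  · simp only [eq_comm (a := k) (b := i)]
    ring
  all_goals fun_prop

/-- The trace reproduces τ = 4ρ(x - c) up to the factor -12μ²ρ², which is what the curvature term
has to cancel. -/
theorem sum_sphericalCovDeriv_sphericalCovDeriv (hμ : μ ≠ 0) (x : EuclideanSpace ℝ (Fin 4))
    (k : Fin 4) :
    ∑ i, sphericalCovDeriv μ c i
      (sphericalCovDeriv μ c i (fun z k => 4 * invQuad μ c z * (z k - c k))) x k =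
        -12 * μ ^ 2 * invQuad μ c x ^ 2 * (4 * invQuad μ c x * (x k - c k)) := by
  have hd := differentiable_invQuad c hμ
  have hρ := invQuad_mul_sum_sq c x hμ
  have hY (i : Fin 4) : sphericalCovDeriv μ c i (fun z k => 4 * invQuad μ c z * (z k - c k)) =
      fun x k => (8 * μ ^ 2 * invQuad μ c x ^ 2 - 4 * invQuad μ c x) * (if i = k then 1 else 0)
        - 8 * invQuad μ c x ^ 2 * (x i - c i) * (x k - c k) :=
    funext₂ fun x k => sphericalCovDeriv_invQuad_mul hμ x i k
  have hp (i : Fin 4) : partialDeriv i (fun x =>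
      (8 * μ ^ 2 * invQuad μ c x ^ 2 - 4 * invQuad μ c x) * (if i = k then 1 else 0)
        - 8 * invQuad μ c x ^ 2 * (x i - c i) * (x k - c k)) x =
      (16 * μ ^ 2 * invQuad μ c x - 4) * (-2 * (x i - c i) * invQuad μ c x ^ 2) *
          (if i = k then 1 else 0)
        - (-32 * (x i - c i) ^ 2 * invQuad μ c x ^ 3 + 8 * invQuad μ c x ^ 2) * (x k - c k)
        - 8 * invQuad μ c x ^ 2 * (x i - c i) * (if k = i then 1 else 0) := by
    rw [partialDeriv_sub, partialDeriv_mul, partialDeriv_sub, partialDeriv_const_mul,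
      partialDeriv_pow, partialDeriv_const_mul, partialDeriv_const, partialDeriv_mul,
      partialDeriv_mul, partialDeriv_const_mul, partialDeriv_pow, partialDeriv_invQuad c x hμ,
      partialDeriv_coord_sub, partialDeriv_coord_sub, if_pos rfl]
    · push_cast
      ring
    all_goals fun_prop
  simp only [hY]
  simp only [sphericalCovDeriv, sum_sphericalChristoffel_mul, hp]
  rw [Fin.sum_univ_four] at hρ
  fin_cases k
  · simp [Fin.sum_univ_four]
    linear_combination 48 * invQuad μ c x ^ 2 * (x 0 - c 0) * hρ
  · simp [Fin.sum_univ_four]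
    linear_combination 48 * invQuad μ c x ^ 2 * (x 1 - c 1) * hρ
  · simp [Fin.sum_univ_four]
    linear_combination 48 * invQuad μ c x ^ 2 * (x 2 - c 2) * hρ
  · simp [Fin.sum_univ_four]
    linear_combination 48 * invQuad μ c x ^ 2 * (x 3 - c 3) * hρ

theorem sphericalPush_tensionField (hv : ‖v‖ = 1) (hLv : ∀ z, inner ℝ (L z) v = 0)
    (hw : ‖w‖ = 1) (hMw : ∀ z, inner ℝ (M z) w = 0)
    (hν : ν ≠ 0) (hμ : μ ≠ 0) (hW : IsOpen W) (hψ : ∀ z ∈ W, DifferentiableAt ℝ ψ z)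
    (hψS : ∀ z ∈ W, sphericalParam L v ν d (ψ z) = sphericalParam M w μ c z)
    {x : EuclideanSpace ℝ (Fin 4)} (hx : x ∈ W) :
    sphericalPush L v ν d (ψ x) (tensionField (sphericalMetric ν d) ψ x) =
      sphericalPush M w μ c x (fun k => 4 * invQuad μ c x * (x k - c k)) := by
  have h1 : tensionField (sphericalMetric ν d) ψ x = fun p => ∑ i,
    covDerivAlong (sphericalMetric ν d) ψ i (fun z d => partialDeriv i (fun w => ψ w d) z) x p := rfl
  simp only [h1, ← sum_sphericalCovDeriv_const, sphericalPush_sum]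
  exact Finset.sum_congr rfl fun i _ =>
    sphericalPush_covDerivAlong hv hLv hw hMw hν hμ hW hψ hψS (fun k => by fun_prop)
      (fun z hz => sphericalPush_partialDeriv hν hW hψ hψS i hz) i hx

/-- The vectors `D i` have squared length λ² = (2μρ)² and are mutually orthogonal in the target
metric. With curvature 1, the sum of R(V, Dᵢ)Dᵢ is 4λ²V - λ²V = 12μ²ρ²V. -/
theorem sphericalPush_curvature (hv : ‖v‖ = 1) (hLv : ∀ z, inner ℝ (L z) v = 0)
    (hw : ‖w‖ = 1) (hMw : ∀ z, inner ℝ (M z) w = 0)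
    (hν : ν ≠ 0) (hμ : μ ≠ 0) {x y : EuclideanSpace ℝ (Fin 4)} {V X : Fin 4 → ℝ}
    {D : Fin 4 → Fin 4 → ℝ}
    (hD : ∀ i, sphericalPush L v ν d y (D i) =
      sphericalPush M w μ c x (fun k => if k = i then 1 else 0))
    (hV : sphericalPush L v ν d y V = sphericalPush M w μ c x X) :
    sphericalPush L v ν d y (fun l => ∑ i, ∑ p, ∑ q, ∑ r,
        riemannCurvature (sphericalMetric ν d) l p q r y * V p * D i q * D i r) =
      (12 * μ ^ 2 * invQuad μ c x ^ 2) • sphericalPush M w μ c x X := by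
  have h1 (i : Fin 4) : (2 * ν * invQuad ν d y) ^ 2 * ∑ q, D i q * D i q =
      (2 * μ * invQuad μ c x) ^ 2 := by
    rw [← inner_sphericalPush hv hLv hν, hD, inner_sphericalPush hw hMw hμ]
    simp
  have h2 (i : Fin 4) : (2 * ν * invQuad ν d y) ^ 2 * ∑ q, V q * D i q =
      (2 * μ * invQuad μ c x) ^ 2 * X i := by
    rw [← inner_sphericalPush hv hLv hν, hD, hV, inner_sphericalPush hw hMw hμ]
    simp
  have h3 (l : Fin 4) : ∑ i, ∑ p, ∑ q, ∑ r,
      riemannCurvature (sphericalMetric ν d) l p q r y * V p * D i q * D i r =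
        16 * μ ^ 2 * invQuad μ c x ^ 2 * V l
          + ∑ i, -(4 * μ ^ 2 * invQuad μ c x ^ 2 * X i) * D i l := by
    have h4 (i : Fin 4) : ∑ p, ∑ q, ∑ r,
        riemannCurvature (sphericalMetric ν d) l p q r y * V p * D i q * D i r =
          (2 * ν * invQuad ν d y) ^ 2 * (∑ q, D i q * D i q) * V l
            - (2 * ν * invQuad ν d y) ^ 2 * (∑ q, V q * D i q) * D i l := by
      simp only [riemannCurvature_sphericalMetric d hν]
      fin_cases l <;> simp [Fin.sum_univ_four] <;> ring
    rw [Finset.sum_congr rfl fun i _ => h4 i]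
    simp only [h1, h2]
    rw [Fin.sum_univ_four, Fin.sum_univ_four]
    ring
  -- V is expanded in the frame `D i`, so that the subtracted sum is recognised as λ²V.
  have h5 : sphericalPush M w μ c x X = ∑ i, X i • sphericalPush L v ν d y (D i) := by
    simp only [hD]
    simp [sphericalPush]
  simp only [h3, sphericalPush_add, sphericalPush_smul, sphericalPush_sum, hV]
  conv_lhs => rw [h5]
  conv_rhs => rw [h5]
  simp only [Fin.sum_univ_four]
  module

theorem bitensionField_eq_zero_of_sphericalParam (hv : ‖v‖ = 1) (hLv : ∀ z, inner ℝ (L z) v = 0)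
    (hw : ‖w‖ = 1) (hMw : ∀ z, inner ℝ (M z) w = 0)
    (hν : ν ≠ 0) (hμ : μ ≠ 0) (hW : IsOpen W) (hψ : ∀ z ∈ W, DifferentiableAt ℝ ψ z)
    (hψS : ∀ z ∈ W, sphericalParam L v ν d (ψ z) = sphericalParam M w μ c z)
    {x : EuclideanSpace ℝ (Fin 4)} (hx : x ∈ W) (l : Fin 4) :
    bitensionField (sphericalMetric ν d) ψ x l = 0 := by
  have hd := differentiable_invQuad c hμ
  have ht (z) (hz : z ∈ W) := sphericalPush_tensionField hv hLv hw hMw hν hμ hW hψ hψS hz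
  have h1 (i : Fin 4) (z) (hz : z ∈ W) :=
    sphericalPush_covDerivAlong hv hLv hw hMw hν hμ hW hψ hψS (fun k => by fun_prop) ht i hz
  -- The second transport needs the first derivative field to be differentiable; its explicit
  -- formula shows this.
  have h2 (i : Fin 4) :=
    sphericalPush_covDerivAlong hv hLv hw hMw hν hμ hW hψ hψS (fun k => by
      simp only [sphericalCovDeriv_invQuad_mul hμ]; fun_prop) (h1 i) i hx
  have h3 := sphericalPush_curvature hv hLv hw hMw hν hμ
    (fun i => sphericalPush_partialDeriv hν hW hψ hψS i hx) (ht x hx)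
  refine sphericalPush_eq_zero (c := d) (x := ψ x) hv hLv hν ?_ l
  have h4 : bitensionField (sphericalMetric ν d) ψ x = fun l =>
      (-1) * (∑ i, covDerivAlong (sphericalMetric ν d) ψ i
        (covDerivAlong (sphericalMetric ν d) ψ i (tensionField (sphericalMetric ν d) ψ)) x l)
      + (-1) * (∑ i, ∑ p, ∑ q, ∑ r, riemannCurvature (sphericalMetric ν d) l p q r (ψ x)
        * tensionField (sphericalMetric ν d) ψ x p
        * partialDeriv i (fun z => ψ z q) x * partialDeriv i (fun z => ψ z r) x) := by
    funext l
    rw [bitensionField]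
    ring
  rw [h4, sphericalPush_add, sphericalPush_smul, sphericalPush_smul, h3, sphericalPush_sum]
  simp only [h2]
  rw [← sphericalPush_sum]
  simp only [sum_sphericalCovDeriv_sphericalCovDeriv hμ]
  rw [sphericalPush_smul]
  module

theorem exists_tensionField_ne_zero_of_sphericalParam (hv : ‖v‖ = 1)
    (hLv : ∀ z, inner ℝ (L z) v = 0) (hw : ‖w‖ = 1) (hMw : ∀ z, inner ℝ (M z) w = 0)
    (hν : ν ≠ 0) (hμ : μ ≠ 0) (hW : IsOpen W) (hψ : ∀ z ∈ W, DifferentiableAt ℝ ψ z)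
    (hψS : ∀ z ∈ W, sphericalParam L v ν d (ψ z) = sphericalParam M w μ c z)
    {x : EuclideanSpace ℝ (Fin 4)} (hx : x ∈ W) (hxc : x ≠ c) :
    ∃ l, tensionField (sphericalMetric ν d) ψ x l ≠ 0 := by
  by_contra! h
  have h1 := sphericalPush_tensionField hv hLv hw hMw hν hμ hW hψ hψS hx
  rw [show tensionField (sphericalMetric ν d) ψ x = fun _ => 0 from funext h] at h1
  have h2 : sphericalPush L v ν d (ψ x) (fun _ => 0) = 0 := by simp [sphericalPush]
  have h3 := (invQuad_pos c x hμ).ne'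
  refine hxc (PiLp.ext fun k => ?_)
  have h4 := sphericalPush_eq_zero hw hMw hμ (h1.symm.trans h2) k
  simpa [h3, sub_eq_zero] using h4

end Bitension

/-! ### Maps into the sphere -/

/-- The atlas consists of stereographic projections onto the hyperplane through the origin with
inverse (|y|² + 4)⁻¹(4y + (|y|² - 4)v), which forces μ = 2 and c = 0. -/
theorem exists_symm_eq_sphericalParam {n : ℕ}
    {e : OpenPartialHomeomorph (UnitSphere n) (EuclideanSpace ℝ (Fin n))}
    (he : e ∈ atlas (EuclideanSpace ℝ (Fin n)) (UnitSphere n)) :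
    ∃ (L : EuclideanSpace ℝ (Fin n) →ₗᵢ[ℝ] EuclideanSpace ℝ (Fin (n + 1)))
      (v : EuclideanSpace ℝ (Fin (n + 1))), ‖v‖ = 1 ∧ (∀ z, inner ℝ (L z) v = 0) ∧
        ∀ y, (e.symm y : EuclideanSpace ℝ (Fin (n + 1))) = sphericalParam L v 2 0 y := by
  have := Fact.mk (@finrank_euclideanSpace_fin ℝ _ (n + 1))
  obtain ⟨v, rfl⟩ : ∃ v : UnitSphere n, e = stereographic' n v := he
  let U : (ℝ ∙ (v : EuclideanSpace ℝ (Fin (n + 1))))ᗮ ≃ₗᵢ[ℝ] EuclideanSpace ℝ (Fin n) :=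
    (OrthonormalBasis.fromOrthogonalSpanSingleton n (ne_zero_of_mem_unit_sphere v)).repr
  refine ⟨(Submodule.subtypeₗᵢ _).comp U.symm.toLinearIsometry, v, norm_eq_of_mem_sphere v,
    fun z => ?_, fun y => ?_⟩
  · exact Submodule.mem_orthogonal_singleton_iff_inner_left.1 (U.symm z).2
  · have hn : ‖((U.symm y : (ℝ ∙ (v : EuclideanSpace ℝ (Fin (n + 1))))ᗮ) :
        EuclideanSpace ℝ (Fin (n + 1)))‖ = ‖y‖ := U.symm.norm_map y
    have h0 : ‖y‖ ^ 2 + 4 ≠ 0 := by positivity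
    rw [stereographic'_symm_apply]
    change (‖((U.symm y : (ℝ ∙ (v : EuclideanSpace ℝ (Fin (n + 1))))ᗮ) :
        EuclideanSpace ℝ (Fin (n + 1)))‖ ^ 2 + 4)⁻¹ • (4 : ℝ) •
          ((U.symm y : (ℝ ∙ (v : EuclideanSpace ℝ (Fin (n + 1))))ᗮ) :
            EuclideanSpace ℝ (Fin (n + 1))) +
        (‖((U.symm y : (ℝ ∙ (v : EuclideanSpace ℝ (Fin (n + 1))))ᗮ) :
          EuclideanSpace ℝ (Fin (n + 1)))‖ ^ 2 + 4)⁻¹ •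
            (‖((U.symm y : (ℝ ∙ (v : EuclideanSpace ℝ (Fin (n + 1))))ᗮ) :
              EuclideanSpace ℝ (Fin (n + 1)))‖ ^ 2 - 4) •
                (v : EuclideanSpace ℝ (Fin (n + 1))) =
      (v : EuclideanSpace ℝ (Fin (n + 1))) - (2 * 2 * (‖y - 0‖ ^ 2 + 2 ^ 2)⁻¹) •
        ((2 : ℝ) • (v : EuclideanSpace ℝ (Fin (n + 1))) -
          ((U.symm (y - 0) : (ℝ ∙ (v : EuclideanSpace ℝ (Fin (n + 1))))ᗮ) :
            EuclideanSpace ℝ (Fin (n + 1))))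
    rw [hn, sub_zero]
    norm_num
    generalize ((U.symm y : (ℝ ∙ (v : EuclideanSpace ℝ (Fin (n + 1))))ᗮ) :
        EuclideanSpace ℝ (Fin (n + 1))) = z
    generalize (v : EuclideanSpace ℝ (Fin (n + 1))) = v
    ext i
    simp only [PiLp.add_apply, PiLp.smul_apply, PiLp.sub_apply, smul_eq_mul]
    field_simp
    ring

theorem chartMetric_eq_sphericalMetric {n : ℕ}
    {e : OpenPartialHomeomorph (UnitSphere n) (EuclideanSpace ℝ (Fin n))}
    {L : EuclideanSpace ℝ (Fin n) →ₗᵢ[ℝ] EuclideanSpace ℝ (Fin (n + 1))}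
    {v : EuclideanSpace ℝ (Fin (n + 1))} {μ : ℝ} {c : EuclideanSpace ℝ (Fin n)} (hμ : μ ≠ 0)
    (hv : ‖v‖ = 1) (hLv : ∀ z, inner ℝ (L z) v = 0)
    (he : ∀ y, (e.symm y : EuclideanSpace ℝ (Fin (n + 1))) = sphericalParam L v μ c y) :
    chartMetric (Subtype.val : UnitSphere n → EuclideanSpace ℝ (Fin (n + 1))) e =
      sphericalMetric μ c := by
  funext y
  ext i j
  simp only [chartMetric, Matrix.of_apply, he, sphericalMetric, Matrix.smul_apply, Matrix.one_apply,
    smul_eq_mul]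
  exact inner_partialDeriv_sphericalParam L c y hv hLv hμ i j

theorem isProperBiharmonicMapOn_of_eq_sphericalParam
    {M : EuclideanSpace ℝ (Fin 4) →ₗᵢ[ℝ] EuclideanSpace ℝ (Fin 5)} {w : EuclideanSpace ℝ (Fin 5)}
    {μ : ℝ} {c : EuclideanSpace ℝ (Fin 4)} (hw : ‖w‖ = 1) (hMw : ∀ z, inner ℝ (M z) w = 0)
    (hμ : μ ≠ 0) {φ : EuclideanSpace ℝ (Fin 4) → UnitSphere 4}
    {U : Set (EuclideanSpace ℝ (Fin 4))} (hU : IsOpen U)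
    (hφ : ∀ x ∈ U, (φ x : EuclideanSpace ℝ (Fin 5)) = sphericalParam M w μ c x)
    (hne : ∃ x ∈ U, x ≠ c) :
    IsProperBiharmonicMapOn 4 (Subtype.val : UnitSphere 4 → EuclideanSpace ℝ (Fin 5)) φ U := by
  have := Fact.mk (@finrank_euclideanSpace_fin ℝ _ (4 + 1))
  have hsmooth : ContMDiffOn (𝓡 4) (𝓡 4) ∞ φ U := by
    have h1 : ContMDiff (𝓡 4) 𝓘(ℝ, EuclideanSpace ℝ (Fin 5)) ∞ (sphericalParam M w μ c) :=
      (contDiff_sphericalParam M c w hμ).contMDiff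
    have h2 (x) : sphericalParam M w μ c x ∈ Metric.sphere (0 : EuclideanSpace ℝ (Fin 5)) 1 := by
      rw [mem_sphere_zero_iff_norm, norm_sphericalParam M c x hw hMw hμ]
    have h3 := h1.codRestrict_sphere (n := 4) h2
    exact h3.contMDiffOn.congr fun x hx => Subtype.ext (hφ x hx)
  -- The open set on which the coordinate expression of φ in the chart e is meaningful; it plays the
  -- role of W.
  have hlocal (e) (he : e ∈ atlas (EuclideanSpace ℝ (Fin 4)) (UnitSphere 4)) :
      IsOpen (U ∩ φ ⁻¹' e.source) ∧
        ∀ z ∈ U ∩ φ ⁻¹' e.source, DifferentiableAt ℝ (fun z => e (φ z)) z := by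
    have hopen := hsmooth.continuousOn.isOpen_inter_preimage hU e.open_source
    refine ⟨hopen, fun z hz => ?_⟩
    have h1 : ContMDiffOn (𝓡 4) (𝓡 4) ∞ e e.source :=
      contMDiffOn_of_mem_maximalAtlas (IsManifold.subset_maximalAtlas he)
    have h2 : ContMDiffOn (𝓡 4) (𝓡 4) ∞ (fun z => e (φ z)) (U ∩ φ ⁻¹' e.source) :=
      h1.comp (hsmooth.mono Set.inter_subset_left) fun z hz => hz.2
    exact ((contMDiffOn_iff_contDiffOn.1 h2).contDiffAt (hopen.mem_nhds hz)).differentiableAt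
      (by simp)
  refine ⟨⟨hsmooth, fun x hx e he hxe l => ?_⟩, fun hharm => ?_⟩
  · obtain ⟨L, v, hv, hLv, hL⟩ := exists_symm_eq_sphericalParam he
    rw [chartMetric_eq_sphericalMetric two_ne_zero hv hLv hL]
    exact bitensionField_eq_zero_of_sphericalParam hv hLv hw hMw two_ne_zero hμ (hlocal e he).1
      (hlocal e he).2 (fun z hz => by rw [← hL, e.left_inv hz.2, hφ z hz.1]) ⟨hx, hxe⟩ l
  · obtain ⟨x, hx, hxc⟩ := hne
    have he := chart_mem_atlas (EuclideanSpace ℝ (Fin 4)) (φ x)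
    have hxe := mem_chart_source (EuclideanSpace ℝ (Fin 4)) (φ x)
    generalize chartAt (EuclideanSpace ℝ (Fin 4)) (φ x) = e at he hxe
    obtain ⟨L, v, hv, hLv, hL⟩ := exists_symm_eq_sphericalParam he
    obtain ⟨l, hl⟩ := exists_tensionField_ne_zero_of_sphericalParam hv hLv hw hMw two_ne_zero hμ
      (hlocal e he).1 (hlocal e he).2
      (fun z hz => by rw [← hL, e.left_inv hz.2, hφ z hz.1]) ⟨hx, hxe⟩ hxc
    have h := hharm.2 x hx e he hxe l
    rw [chartMetric_eq_sphericalMetric two_ne_zero hv hLv hL] at h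
    exact hl h

/-! ### Möbius transformations as spherical parametrizations -/

section Snoc

variable {n : ℕ}

/-- The vector `(u, r)` of `ℝⁿ⁺¹ = ℝⁿ × ℝ`. -/
def snocVec (u : EuclideanSpace ℝ (Fin n)) (r : ℝ) : EuclideanSpace ℝ (Fin (n + 1)) :=
  WithLp.toLp 2 (Fin.snoc (α := fun _ => ℝ) (fun i => u i) r)

theorem snocVec_castSucc (u : EuclideanSpace ℝ (Fin n)) (r : ℝ) (i : Fin n) :
    snocVec u r i.castSucc = u i := by simp [snocVec]

theorem snocVec_last (u : EuclideanSpace ℝ (Fin n)) (r : ℝ) :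
    snocVec u r (Fin.last n) = r := by simp [snocVec]

theorem ext_snocVec {u v : EuclideanSpace ℝ (Fin (n + 1))}
    (h : ∀ i : Fin n, u i.castSucc = v i.castSucc)
    (hl : u (Fin.last n) = v (Fin.last n)) : u = v :=
  PiLp.ext fun i => Fin.lastCases hl h i

theorem inner_snocVec (u u' : EuclideanSpace ℝ (Fin n)) (r r' : ℝ) :
    inner ℝ (snocVec u r) (snocVec u' r') = inner ℝ u u' + r * r' := by
  simp [PiLp.inner_apply, Fin.sum_univ_castSucc, snocVec_castSucc, snocVec_last, mul_comm]

theorem norm_sq_snocVec (u : EuclideanSpace ℝ (Fin n)) (r : ℝ) :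
    ‖snocVec u r‖ ^ 2 = ‖u‖ ^ 2 + r ^ 2 := by
  rw [← real_inner_self_eq_norm_sq, inner_snocVec, real_inner_self_eq_norm_sq, sq r]

theorem coe_invStereo (y : EuclideanSpace ℝ (Fin n)) :
    (invStereo y : EuclideanSpace ℝ (Fin (n + 1))) =
      (‖y‖ ^ 2 + 1)⁻¹ • snocVec ((2 : ℝ) • y) (‖y‖ ^ 2 - 1) := by
  refine ext_snocVec (fun i => ?_) ?_ <;>
    simp [invStereo, snocVec]

theorem coe_northPole : (northPole n : EuclideanSpace ℝ (Fin (n + 1))) = snocVec 0 1 := by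
  refine ext_snocVec (fun i => ?_) ?_ <;>
    simp [northPole, snocVec_castSucc, snocVec_last, (Fin.castSucc_lt_last _).ne]

/-- A linear isometry of `ℝⁿ` onto the orthogonal complement in `ℝⁿ⁺¹` of the image of `p` under
inverse stereographic projection. -/
def tangentIsometry (A : EuclideanSpace ℝ (Fin n) ≃ₗᵢ[ℝ] EuclideanSpace ℝ (Fin n))
    (p : EuclideanSpace ℝ (Fin n)) :
    EuclideanSpace ℝ (Fin n) →ₗᵢ[ℝ] EuclideanSpace ℝ (Fin (n + 1)) where
  -- This is A followed by the differential of inverse stereographic projection at p, divided by its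
  -- conformal factor 2/(|p|² + 1).
  toFun z := snocVec (A z - (2 * inner ℝ p (A z) / (‖p‖ ^ 2 + 1)) • p)
    (2 * inner ℝ p (A z) / (‖p‖ ^ 2 + 1))
  map_add' y z := by
    refine ext_snocVec (fun i => ?_) ?_
    · simp only [snocVec_castSucc, PiLp.add_apply, PiLp.sub_apply, PiLp.smul_apply, map_add,
        inner_add_right, smul_eq_mul]
      ring
    · simp only [snocVec_last, PiLp.add_apply, map_add, inner_add_right]
      ring
  map_smul' r z := by
    refine ext_snocVec (fun i => ?_) ?_
    · simp only [snocVec_castSucc, PiLp.sub_apply, PiLp.smul_apply, map_smul,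
        inner_smul_right, smul_eq_mul, RingHom.id_apply]
      ring
    · simp only [snocVec_last, PiLp.smul_apply, map_smul, inner_smul_right, smul_eq_mul,
        RingHom.id_apply]
      ring
  norm_map' z := by
    have h0 : ‖p‖ ^ 2 + 1 ≠ 0 := by positivity
    rw [← sq_eq_sq₀ (norm_nonneg _) (norm_nonneg _)]
    change ‖snocVec _ _‖ ^ 2 = _
    rw [norm_sq_snocVec, norm_sub_sq_real, inner_smul_right, norm_smul, mul_pow, Real.norm_eq_abs,
      sq_abs, A.norm_map, real_inner_comm]
    field_simp
    ring

theorem tangentIsometry_apply (A : EuclideanSpace ℝ (Fin n) ≃ₗᵢ[ℝ] EuclideanSpace ℝ (Fin n))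
    (p z : EuclideanSpace ℝ (Fin n)) :
    tangentIsometry A p z = snocVec (A z - (2 * inner ℝ p (A z) / (‖p‖ ^ 2 + 1)) • p)
      (2 * inner ℝ p (A z) / (‖p‖ ^ 2 + 1)) := rfl

theorem inner_tangentIsometry (A : EuclideanSpace ℝ (Fin n) ≃ₗᵢ[ℝ] EuclideanSpace ℝ (Fin n))
    (p z : EuclideanSpace ℝ (Fin n)) :
    inner ℝ (tangentIsometry A p z) (invStereo p : EuclideanSpace ℝ (Fin (n + 1))) = 0 := by
  have h0 : ‖p‖ ^ 2 + 1 ≠ 0 := by positivity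
  rw [tangentIsometry_apply, coe_invStereo, inner_smul_right, inner_snocVec, inner_smul_right,
    inner_sub_left, inner_smul_left, real_inner_self_eq_norm_sq, real_inner_comm]
  simp only [conj_trivial]
  field_simp
  ring

end Snoc

section Mobius

variable {n : ℕ} (a b : EuclideanSpace ℝ (Fin n)) {α : ℝ}
  (A : EuclideanSpace ℝ (Fin n) ≃ₗᵢ[ℝ] EuclideanSpace ℝ (Fin n))

/-- The pole is the limit at infinity, here the north pole, and the centre is the zero of the
similarity, which is sent to the south pole. -/
theorem mobiusToSphere_zero (hα : α ≠ 0) (x : EuclideanSpace ℝ (Fin n)) :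
    (mobiusToSphere a b α A 0 x : EuclideanSpace ℝ (Fin (n + 1))) =
      sphericalParam (tangentIsometry A 0) (northPole n) α⁻¹ (b - α⁻¹ • A.symm a) x := by
  have hy : mobius a b α A 0 x = α • A (x - (b - α⁻¹ • A.symm a)) := by
    simp [mobius, smul_sub, hα]
    abel
  rw [mobiusToSphere, if_pos (show x ∈ mobiusDomain b 0 from Or.inl rfl), coe_invStereo, hy, norm_smul, mul_pow, A.norm_map,
    Real.norm_eq_abs, sq_abs, sphericalParam, invQuad, coe_northPole, tangentIsometry_apply]
  generalize x - (b - α⁻¹ • A.symm a) = z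
  have h0 : α ^ 2 * ‖z‖ ^ 2 + 1 ≠ 0 := by positivity
  refine ext_snocVec (fun i => ?_) ?_
  · simp only [snocVec_castSucc, PiLp.sub_apply, PiLp.smul_apply, smul_eq_mul, PiLp.zero_apply]
    field_simp
    ring
  · simp only [snocVec_last, PiLp.sub_apply, PiLp.smul_apply, smul_eq_mul, inner_zero_left]
    field_simp
    ring

/-- As x tends to infinity the Möbius map tends to a, so the pole is the image of a on the sphere.
The centre is the point sent to the antipode of that pole. -/
theorem mobiusToSphere_two (hα : α ≠ 0) (x : EuclideanSpace ℝ (Fin n)) :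
    (mobiusToSphere a b α A 2 x : EuclideanSpace ℝ (Fin (n + 1))) =
      sphericalParam (tangentIsometry A a) (invStereo a) (α / (‖a‖ ^ 2 + 1))
        (b - (α / (‖a‖ ^ 2 + 1)) • A.symm a) x := by
  obtain ⟨u, rfl⟩ : ∃ u, x = b + A.symm u := ⟨A (x - b), by simp⟩
  obtain ⟨s, hs⟩ : ∃ s, s = ‖a‖ ^ 2 + 1 := ⟨_, rfl⟩
  have hs0 : 0 < s := by rw [hs]; positivity
  have ha : ‖a‖ ^ 2 = s - 1 := by rw [hs]; ring
  obtain ⟨μ, rfl⟩ : ∃ μ, α = μ * s := ⟨α / s, by field_simp⟩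
  have hμ : μ ≠ 0 := left_ne_zero_of_mul hα
  have hz : b + A.symm u - (b - μ • A.symm a) = A.symm (u + μ • a) := by
    rw [map_add, map_smul]
    abel
  rw [← hs, mul_div_cancel_right₀ _ hs0.ne', sphericalParam, invQuad, hz, A.symm.norm_map,
    tangentIsometry_apply, A.apply_symm_apply, ← hs, inner_add_right, inner_smul_right,
    real_inner_self_eq_norm_sq, ha, norm_add_sq_real, inner_smul_right, norm_smul, mul_pow,
    Real.norm_eq_abs, sq_abs, ha, real_inner_comm, coe_invStereo a, ← hs, ha]
  have hD : 0 < ‖u‖ ^ 2 + 2 * (μ * inner ℝ a u) + μ ^ 2 * (s - 1) + μ ^ 2 := by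
    have h1 : 0 < ‖u + μ • a‖ ^ 2 + μ ^ 2 := by positivity
    rwa [norm_add_sq_real, inner_smul_right, norm_smul, mul_pow, Real.norm_eq_abs, sq_abs, ha,
      real_inner_comm] at h1
  -- The case u = 0 is x = b, where the formula must give the north pole.
  by_cases hu : u = 0
  · subst hu
    rw [mobiusToSphere, if_neg (by simp [mobiusDomain]), coe_northPole]
    have h1 : ‖(0 : EuclideanSpace ℝ (Fin n))‖ ^ 2 + 2 * (μ * inner ℝ a 0) + μ ^ 2 * (s - 1)
        + μ ^ 2 = μ ^ 2 * s := by
      rw [inner_zero_right, norm_zero]; ring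
    rw [h1]
    refine ext_snocVec (fun i => ?_) ?_
    · simp only [snocVec_castSucc, PiLp.sub_apply, PiLp.smul_apply, smul_eq_mul, PiLp.zero_apply,
        PiLp.add_apply, inner_zero_right]
      field_simp
      ring
    · simp only [snocVec_last, PiLp.sub_apply, PiLp.smul_apply, smul_eq_mul, inner_zero_right]
      field_simp
      ring
  · have hN : ‖u‖ ≠ 0 := norm_ne_zero_iff.2 hu
    have hy : mobius a b (μ * s) A 2 (b + A.symm u) = a + (μ * s / ‖u‖ ^ 2) • u := by
      simp [mobius]
    have hy2 : ‖a + (μ * s / ‖u‖ ^ 2) • u‖ ^ 2 =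
        s * (‖u‖ ^ 2 + 2 * (μ * inner ℝ a u) + μ ^ 2 * (s - 1) + μ ^ 2) / ‖u‖ ^ 2 - 1 := by
      rw [norm_add_sq_real, inner_smul_right, norm_smul, mul_pow, Real.norm_eq_abs, sq_abs, ha]
      field_simp
      ring
    rw [mobiusToSphere, if_pos (show b + A.symm u ∈ mobiusDomain b 2 from Or.inr (by simpa using hu)), coe_invStereo, hy, hy2]
    have hD' := hD.ne'
    generalize hDd : ‖u‖ ^ 2 + 2 * (μ * inner ℝ a u) + μ ^ 2 * (s - 1) + μ ^ 2 = D at *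
    -- The inner product is traded for the common denominator D, leaving rational identities in
    -- independent quantities.
    have ht : inner ℝ a u = (D - ‖u‖ ^ 2 - μ ^ 2 * s) / (2 * μ) := by
      rw [← hDd]; field_simp; ring
    refine ext_snocVec (fun i => ?_) ?_
    · simp only [snocVec_castSucc, PiLp.sub_apply, PiLp.smul_apply, smul_eq_mul, PiLp.add_apply, ht]
      field_simp
      ring
    · simp only [snocVec_last, PiLp.sub_apply, PiLp.smul_apply, smul_eq_mul, ht]
      field_simp
      ring

theorem exists_mobiusToSphere_eq_sphericalParam (hα : α ≠ 0) {ε : ℕ} (hε : ε = 0 ∨ ε = 2) :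
    ∃ (M : EuclideanSpace ℝ (Fin n) →ₗᵢ[ℝ] EuclideanSpace ℝ (Fin (n + 1)))
      (w : EuclideanSpace ℝ (Fin (n + 1))) (μ : ℝ) (c : EuclideanSpace ℝ (Fin n)),
      ‖w‖ = 1 ∧ (∀ z, inner ℝ (M z) w = 0) ∧ μ ≠ 0 ∧
        ∀ x, (mobiusToSphere a b α A ε x : EuclideanSpace ℝ (Fin (n + 1))) =
          sphericalParam M w μ c x := by
  rcases hε with rfl | rfl
  · refine ⟨_, _, _, _, norm_eq_of_mem_sphere _, fun z => ?_, inv_ne_zero hα,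
      mobiusToSphere_zero a b A hα⟩
    rw [tangentIsometry_apply, coe_northPole, inner_snocVec]
    simp
  · exact ⟨_, _, _, _, norm_eq_of_mem_sphere _, inner_tangentIsometry A a,
      div_ne_zero hα (by positivity), mobiusToSphere_two a b A hα⟩

end Mobius

/-! ### Maps into flat space -/

section Flat

variable {m n : ℕ}

theorem chartMetric_id
    {e : OpenPartialHomeomorph (EuclideanSpace ℝ (Fin n)) (EuclideanSpace ℝ (Fin n))}
    (he : e ∈ atlas (EuclideanSpace ℝ (Fin n)) (EuclideanSpace ℝ (Fin n))) :
    chartMetric (id : EuclideanSpace ℝ (Fin n) → EuclideanSpace ℝ (Fin n)) e = fun _ => 1 := by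
  rw [chartedSpaceSelf_atlas.1 he]
  funext y
  ext i j
  have h (i : Fin n) : partialDeriv i (fun z : EuclideanSpace ℝ (Fin n) => z) y =
      EuclideanSpace.single i 1 := by simp [partialDeriv]
  simp [chartMetric, h, Matrix.one_apply, EuclideanSpace.inner_single_left, PiLp.single_apply]

theorem christoffel_one (k i j : Fin n) :
    christoffel (fun _ : EuclideanSpace ℝ (Fin n) => (1 : Matrix (Fin n) (Fin n) ℝ)) k i j =
      fun _ => 0 := by
  funext y
  simp [christoffel, partialDeriv_const]

theorem riemannCurvature_one (l i j k : Fin n) (y : EuclideanSpace ℝ (Fin n)) :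
    riemannCurvature (fun _ => (1 : Matrix (Fin n) (Fin n) ℝ)) l i j k y = 0 := by
  simp [riemannCurvature, christoffel_one, partialDeriv_const]

/-- The Laplacian `∑ᵢ ∂ᵢ∂ᵢ f` of a function on `ℝᵐ`. -/
def laplacianSum (f : EuclideanSpace ℝ (Fin m) → ℝ) (x : EuclideanSpace ℝ (Fin m)) : ℝ :=
  ∑ i, partialDeriv i (partialDeriv i f) x

theorem laplacianSum_congr {f g : EuclideanSpace ℝ (Fin m) → ℝ} {x : EuclideanSpace ℝ (Fin m)}
    (h : f =ᶠ[nhds x] g) : laplacianSum f x = laplacianSum g x := by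
  refine Finset.sum_congr rfl fun i _ => partialDeriv_congr ?_
  filter_upwards [h.eventually_nhds] with z hz using partialDeriv_congr hz

theorem tensionField_one (φ : EuclideanSpace ℝ (Fin m) → EuclideanSpace ℝ (Fin n))
    (x : EuclideanSpace ℝ (Fin m)) (c : Fin n) :
    tensionField (fun _ => 1) φ x c = laplacianSum (fun z => φ z c) x := by
  simp only [tensionField, covDerivAlong, christoffel_one, zero_mul, Finset.sum_const_zero, add_zero,
    laplacianSum]

theorem bitensionField_one (φ : EuclideanSpace ℝ (Fin m) → EuclideanSpace ℝ (Fin n))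
    (x : EuclideanSpace ℝ (Fin m)) (c : Fin n) :
    bitensionField (fun _ => 1) φ x c =
      -laplacianSum (laplacianSum fun z => φ z c) x := by
  simp only [bitensionField, covDerivAlong, christoffel_one, riemannCurvature_one, zero_mul,
    Finset.sum_const_zero, add_zero, tensionField_one, sub_zero]
  rfl

theorem isHarmonicMapOn_id_iff {φ : EuclideanSpace ℝ (Fin m) → EuclideanSpace ℝ (Fin n)}
    {U : Set (EuclideanSpace ℝ (Fin m))} :
    IsHarmonicMapOn n (id : EuclideanSpace ℝ (Fin n) → EuclideanSpace ℝ (Fin n)) φ U ↔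
      ContDiffOn ℝ ∞ φ U ∧ ∀ x ∈ U, ∀ c, laplacianSum (fun z => φ z c) x = 0 := by
  rw [IsHarmonicMapOn, contMDiffOn_iff_contDiffOn]
  refine and_congr_right fun _ => forall₂_congr fun x _ => ⟨fun h c => ?_, fun h e he _ c => ?_⟩
  · have h1 := h _ (chart_mem_atlas _ (φ x)) (mem_chart_source _ _) c
    rw [chartMetric_id (chart_mem_atlas _ (φ x)), tensionField_one, chartAt_self_eq] at h1
    exact h1
  · rw [chartMetric_id he, chartedSpaceSelf_atlas.1 he, tensionField_one]
    exact h c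

theorem isBiharmonicMapOn_id {φ : EuclideanSpace ℝ (Fin m) → EuclideanSpace ℝ (Fin n)}
    {U : Set (EuclideanSpace ℝ (Fin m))} (hφ : ContDiffOn ℝ ∞ φ U)
    (h : ∀ x ∈ U, ∀ c, laplacianSum (laplacianSum fun z => φ z c) x = 0) :
    IsBiharmonicMapOn n (id : EuclideanSpace ℝ (Fin n) → EuclideanSpace ℝ (Fin n)) φ U := by
  refine ⟨contMDiffOn_iff_contDiffOn.2 hφ, fun x hx e he _ c => ?_⟩
  rw [chartMetric_id he, chartedSpaceSelf_atlas.1 he, bitensionField_one]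
  exact neg_eq_zero.2 (h x hx c)

end Flat

/-! ### Laplacians of Möbius transformations of ℝ⁴. -/

section MobiusFlat

theorem isOpen_mobiusDomain {n : ℕ} (b : EuclideanSpace ℝ (Fin n)) (ε : ℕ) :
    IsOpen (mobiusDomain b ε) := by
  by_cases h : ε = 0
  · simp [mobiusDomain, h]
  · simpa [mobiusDomain, h] using isOpen_ne

theorem contDiffOn_mobius {n : ℕ} (a b : EuclideanSpace ℝ (Fin n)) (α : ℝ)
    (A : EuclideanSpace ℝ (Fin n) ≃ₗᵢ[ℝ] EuclideanSpace ℝ (Fin n)) {ε : ℕ} (hε : ε = 0 ∨ ε = 2) :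
    ContDiffOn ℝ ∞ (mobius a b α A ε) (mobiusDomain b ε) := by
  have h1 : ContDiff ℝ ∞ fun x => A (x - b) :=
    A.toContinuousLinearEquiv.contDiff.comp (contDiff_id.sub contDiff_const)
  rcases hε with rfl | rfl
  · have h2 : ContDiff ℝ ∞ (mobius a b α A 0) := by
      unfold mobius
      simp only [pow_zero]
      fun_prop
    exact h2.contDiffOn
  · have h2 : ContDiffOn ℝ ∞ (fun x => α / ‖x - b‖ ^ 2) (mobiusDomain b 2) := by
      refine contDiffOn_const.div
        ((contDiff_id.sub contDiff_const).norm_sq ℝ).contDiffOn fun x hx => ?_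
      have hx : x ≠ b := by simpa [mobiusDomain] using hx
      simpa [sub_eq_zero] using hx
    exact contDiffOn_const.add (h2.smul h1.contDiffOn)

/-- In dimension n, a linear form times |x - b|⁻²ˢ has Laplacian 2s(2s - n) times the form times |x
- b|⁻²ˢ⁻²; here n = 4 and s = k + 1. The factor k - 1 is real: it is -1 at k = 0 (not harmonic) and
0 at k = 1 (the Kelvin transform). -/
theorem laplacianSum_linear_mul_invQuad_pow {r : ℝ} {b x : EuclideanSpace ℝ (Fin 4)} (hx : x ≠ b)
    (ℓ : EuclideanSpace ℝ (Fin 4) →L[ℝ] ℝ) (k : ℕ) :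
    laplacianSum (fun z => r * (ℓ (z - b) * invQuad 0 b z ^ (k + 1))) x =
      4 * (k + 1) * (k - 1) * r * (ℓ (x - b) * invQuad 0 b x ^ (k + 2)) := by
  have hne {z : EuclideanSpace ℝ (Fin 4)} (hz : z ≠ b) : ‖z - b‖ ^ 2 + (0 : ℝ) ^ 2 ≠ 0 := by
    simpa [sub_eq_zero] using hz
  have hd {z : EuclideanSpace ℝ (Fin 4)} (hz : z ≠ b) : DifferentiableAt ℝ (invQuad 0 b) z :=
    (hasFDerivAt_invQuad b (hne hz)).differentiableAt
  have hℓ (z) : DifferentiableAt ℝ (fun z => ℓ (z - b)) z := by fun_prop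
  have h1 (i : Fin 4) (z) (hz : z ≠ b) :
      partialDeriv i (fun z => r * (ℓ (z - b) * invQuad 0 b z ^ (k + 1))) z =
        r * (ℓ (EuclideanSpace.single i 1) * invQuad 0 b z ^ (k + 1)
          - 2 * (k + 1) * ((z i - b i) * (ℓ (z - b) * invQuad 0 b z ^ (k + 2)))) := by
    have hdz := hd hz
    rw [partialDeriv_const_mul, partialDeriv_mul, partialDeriv_linear_comp_sub, partialDeriv_pow,
      partialDeriv_invQuad_of_ne b (hne hz)]
    · push_cast [Nat.add_sub_cancel]
      ring
    all_goals fun_prop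
  have hdx := hd hx
  have h2 (i : Fin 4) : partialDeriv i
      (partialDeriv i (fun z => r * (ℓ (z - b) * invQuad 0 b z ^ (k + 1)))) x =
        r * (ℓ (EuclideanSpace.single i 1) *
            ((k + 1) * invQuad 0 b x ^ k * (-2 * (x i - b i) * invQuad 0 b x ^ 2))
          - 2 * (k + 1) * ((ℓ (x - b) * invQuad 0 b x ^ (k + 2))
            + (x i - b i) * (ℓ (EuclideanSpace.single i 1) * invQuad 0 b x ^ (k + 2)
              + ℓ (x - b) *
                ((k + 2) * invQuad 0 b x ^ (k + 1) * (-2 * (x i - b i) * invQuad 0 b x ^ 2))))) := by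
    have h3 : partialDeriv i (fun z => r * (ℓ (z - b) * invQuad 0 b z ^ (k + 1))) =ᶠ[nhds x]
        fun z => r * (ℓ (EuclideanSpace.single i 1) * invQuad 0 b z ^ (k + 1)
          - 2 * (k + 1) * ((z i - b i) * (ℓ (z - b) * invQuad 0 b z ^ (k + 2)))) := by
      filter_upwards [isOpen_ne.mem_nhds hx] with z hz using h1 i z hz
    rw [partialDeriv_congr h3, partialDeriv_const_mul, partialDeriv_sub, partialDeriv_const_mul,
      partialDeriv_const_mul, partialDeriv_mul, partialDeriv_mul, partialDeriv_coord_sub,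
      partialDeriv_linear_comp_sub, partialDeriv_pow, partialDeriv_pow,
      partialDeriv_invQuad_of_ne b (hne hx), if_pos rfl]
    · push_cast [Nat.add_sub_cancel, show k + 2 - 1 = k + 1 from rfl]
      ring
    all_goals fun_prop
  have h4 : invQuad 0 b x * ∑ i, (x i - b i) ^ 2 = 1 := by
    have h5 : ‖x - b‖ ^ 2 = ∑ i, (x i - b i) ^ 2 := by simp [EuclideanSpace.norm_sq_eq]
    have h6 := hne hx
    rw [← h5, invQuad]
    simpa using inv_mul_cancel₀ h6
  have h7 : ℓ (x - b) = ∑ i, (x i - b i) * ℓ (EuclideanSpace.single i 1) := by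
    conv_lhs => rw [← (EuclideanSpace.basisFun (Fin 4) ℝ).sum_repr (x - b)]
    simp
  rw [laplacianSum]
  simp only [h2]
  rw [Fin.sum_univ_four] at h4 h7 ⊢
  -- `h7` is Euler's identity for the linear form and `h4` says ρ|x - b|² = 1.
  linear_combination (4 * r * (k + 1) * invQuad 0 b x ^ (k + 2)) * h7
    + (4 * r * (k + 1) * (k + 2) * ℓ (x - b) * invQuad 0 b x ^ (k + 2)) * h4

variable (a b : EuclideanSpace ℝ (Fin 4)) (α : ℝ)
    (A : EuclideanSpace ℝ (Fin 4) ≃ₗᵢ[ℝ] EuclideanSpace ℝ (Fin 4))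

theorem laplacianSum_mobius_zero (x : EuclideanSpace ℝ (Fin 4)) (c : Fin 4) :
    laplacianSum (fun z => mobius a b α A 0 z c) x = 0 := by
  let ℓ : EuclideanSpace ℝ (Fin 4) →L[ℝ] ℝ :=
    (EuclideanSpace.proj c).comp A.toContinuousLinearEquiv.toContinuousLinearMap
  have h1 : (fun z => mobius a b α A 0 z c) = fun z => a c + α * ℓ (z - b) := by
    funext z
    simp [mobius, ℓ]
  have h2 (i : Fin 4) : partialDeriv i (fun z => a c + α * ℓ (z - b)) =
      fun _ => α * ℓ (EuclideanSpace.single i 1) := by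
    funext z
    rw [partialDeriv_add, partialDeriv_const, partialDeriv_const_mul, partialDeriv_linear_comp_sub,
      zero_add]
    all_goals fun_prop
  rw [h1, laplacianSum]
  simp only [h2, partialDeriv_const, Finset.sum_const_zero]

theorem laplacianSum_mobius_two {x : EuclideanSpace ℝ (Fin 4)} (hx : x ≠ b) (c : Fin 4) :
    laplacianSum (fun z => mobius a b α A 2 z c) x =
      -4 * α * (A (x - b) c * invQuad 0 b x ^ 2) := by
  let ℓ : EuclideanSpace ℝ (Fin 4) →L[ℝ] ℝ :=
    (EuclideanSpace.proj c).comp A.toContinuousLinearEquiv.toContinuousLinearMap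
  have hd : DifferentiableAt ℝ (invQuad 0 b) x :=
    (hasFDerivAt_invQuad b (by simpa [sub_eq_zero] using hx)).differentiableAt
  have h1 : (fun z => mobius a b α A 2 z c) =
      fun z => a c + α * (ℓ (z - b) * invQuad 0 b z ^ (0 + 1)) := by
    funext z
    simp [mobius, ℓ, invQuad]
    ring
  have h2 := laplacianSum_linear_mul_invQuad_pow (r := α) hx ℓ 0
  have h3 (i : Fin 4) : partialDeriv i
      (fun z => a c + α * (ℓ (z - b) * invQuad 0 b z ^ (0 + 1))) =
      partialDeriv i fun z => α * (ℓ (z - b) * invQuad 0 b z ^ (0 + 1)) := by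
    funext z
    simp [partialDeriv]
  rw [h1, laplacianSum]
  simp only [h3]
  rw [laplacianSum] at h2
  rw [h2]
  simp [ℓ]

theorem laplacianSum_laplacianSum_mobius_two {x : EuclideanSpace ℝ (Fin 4)} (hx : x ≠ b)
    (c : Fin 4) :
    laplacianSum (laplacianSum fun z => mobius a b α A 2 z c) x = 0 := by
  let ℓ : EuclideanSpace ℝ (Fin 4) →L[ℝ] ℝ :=
    (EuclideanSpace.proj c).comp A.toContinuousLinearEquiv.toContinuousLinearMap
  have h1 : (laplacianSum fun z => mobius a b α A 2 z c) =ᶠ[nhds x]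
      fun z => -4 * α * (ℓ (z - b) * invQuad 0 b z ^ (1 + 1)) := by
    filter_upwards [isOpen_ne.mem_nhds hx] with z hz
      using laplacianSum_mobius_two a b α A hz c
  -- At k = 1 the factor k - 1 vanishes.
  rw [laplacianSum_congr h1, laplacianSum_linear_mul_invQuad_pow hx ℓ 1]
  simp

theorem isBiharmonicMapOn_mobius {ε : ℕ} (hε : ε = 0 ∨ ε = 2) :
    IsBiharmonicMapOn 4 (id : EuclideanSpace ℝ (Fin 4) → EuclideanSpace ℝ (Fin 4))
      (mobius a b α A ε) (mobiusDomain b ε) := by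
  refine isBiharmonicMapOn_id (contDiffOn_mobius a b α A hε) fun x hx c => ?_
  rcases hε with rfl | rfl
  · have h : (laplacianSum fun z => mobius a b α A 0 z c) = fun _ => 0 :=
      funext fun x => laplacianSum_mobius_zero a b α A x c
    have h2 (i : Fin 4) : partialDeriv i (fun _ : EuclideanSpace ℝ (Fin 4) => (0 : ℝ)) =
        fun _ => 0 := funext fun x => partialDeriv_const i 0
    rw [h, laplacianSum]
    simp [h2]
  · exact laplacianSum_laplacianSum_mobius_two a b α A (by simpa [mobiusDomain] using hx) c

theorem isHarmonicMapOn_mobius_iff {α : ℝ} (hα : α ≠ 0) {ε : ℕ} (hε : ε = 0 ∨ ε = 2) :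
    IsHarmonicMapOn 4 (id : EuclideanSpace ℝ (Fin 4) → EuclideanSpace ℝ (Fin 4))
      (mobius a b α A ε) (mobiusDomain b ε) ↔ ε = 0 := by
  rw [isHarmonicMapOn_id_iff]
  refine ⟨fun h => hε.resolve_right ?_, ?_⟩
  · rintro rfl
    obtain ⟨x, hx⟩ := exists_ne b
    have h0 : invQuad 0 b x ≠ 0 := by
      simpa [invQuad, sub_eq_zero] using hx
    have h1 : A (x - b) = 0 := PiLp.ext fun c => by
      have h2 := h.2 x (Or.inr hx) c
      rw [laplacianSum_mobius_two a b α A hx] at h2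
      simpa [hα, h0] using h2
    exact hx (sub_eq_zero.1 (A.map_eq_zero_iff.1 h1))
  · rintro rfl
    exact ⟨contDiffOn_mobius a b α A (Or.inl rfl),
      fun x _ c => laplacianSum_mobius_zero a b α A x c⟩

end MobiusFlat

/-- The tension field of the spherical map vanishes at c, so non-harmonicity is tested at another
point. -/
theorem exists_mem_mobiusDomain_ne (b c : EuclideanSpace ℝ (Fin 4)) (ε : ℕ) :
    ∃ x ∈ mobiusDomain b ε, x ≠ c := by
  obtain ⟨x, hx⟩ := (Set.toFinite ({b, c} : Set (EuclideanSpace ℝ (Fin 4)))).infinite_compl.nonempty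
  simp only [Set.mem_compl_iff, Set.mem_insert_iff, Set.mem_singleton_iff, not_or] at hx
  exact ⟨x, Or.inr hx.1, hx.2⟩

end

theorem mainTheorem7 (a b : EuclideanSpace ℝ (Fin 4)) (α : ℝ) (hα : α ≠ 0)
    (A : EuclideanSpace ℝ (Fin 4) ≃ₗᵢ[ℝ] EuclideanSpace ℝ (Fin 4))
    (ε : ℕ) (hε : ε = 0 ∨ ε = 2) :
    IsBiharmonicMapOn 4 (id : EuclideanSpace ℝ (Fin 4) → EuclideanSpace ℝ (Fin 4))
        (mobius a b α A ε) (mobiusDomain b ε) ∧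
      (IsProperBiharmonicMapOn 4 (id : EuclideanSpace ℝ (Fin 4) → EuclideanSpace ℝ (Fin 4))
        (mobius a b α A ε) (mobiusDomain b ε) ↔ ε ≠ 0) ∧
      IsProperBiharmonicMapOn 4 (Subtype.val : UnitSphere 4 → EuclideanSpace ℝ (Fin 5))
        (fun x => invStereo (mobius a b α A ε x)) (mobiusDomain b ε) ∧
      IsProperBiharmonicMapOn 4 (Subtype.val : UnitSphere 4 → EuclideanSpace ℝ (Fin 5))
        (mobiusToSphere a b α A ε) Set.univ := by
  obtain ⟨M, w, μ, c, hw, hMw, hμ, h⟩ := exists_mobiusToSphere_eq_sphericalParam a b A hα hε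
  refine ⟨isBiharmonicMapOn_mobius a b α A hε, ?_, ?_, ?_⟩
  · rw [IsProperBiharmonicMapOn, isHarmonicMapOn_mobius_iff a b A hα hε]
    exact and_iff_right (isBiharmonicMapOn_mobius a b α A hε)
  · refine isProperBiharmonicMapOn_of_eq_sphericalParam hw hMw hμ (isOpen_mobiusDomain b ε)
      (fun x hx => ?_) (exists_mem_mobiusDomain_ne b c ε)
    rw [← h, mobiusToSphere, if_pos hx]
  · obtain ⟨x, -, hx⟩ := exists_mem_mobiusDomain_ne b c ε
    exact isProperBiharmonicMapOn_of_eq_sphericalParam hw hMw hμ isOpen_univ (fun x _ => h x)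
      ⟨x, Set.mem_univ x, hx⟩
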